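/- **Setting.** Let $R$ be a ring with identity and $(X,\le)$ a finite graded poset: $\dim:X\to\mathbb N$ satisfies $\dim y=\dim x+1$ whenever $y$ covers $x$ (written $x\prec y$). Put $x_+=\{y: x\prec y\}$ and $x_-=\{y: y\prec x\}$. Let $F$ be a cochain complex of finitely generated free $R$-modules parametrized over $X$: modules $F(x)$ with chosen finite bases and linear maps $F_{xy}:F(x)\to F(y)$, zero unless $x\prec y$, such that the maps $d^k:\bigoplus_{\dim x=k}F(x)\to\bigoplus_{\dim y=k+1}F(y)$ with blocks $F_{xy}$ satisfy $d^{k+1}d^k=0$. An *acyclic matching* is a set $\Sigma\subset X\times X$ of pairs $(x,y)$ with $x\prec y$, no element lying in two pairs, such that the transitive closure of the relation $(x,y)\lhd(x',y')\Leftrightarrow x\prec y'$ on $\Sigma$ is a partial order; it is *$F$-compatible* if $F_{xy}$ is invertible for all $(x,y)\in\Sigma$. The *critical* elements are those in no pair. A *gradient path* is a sequence $\gamma=(x_j,y_j)_{j=1}^J$, $J\ge1$, in $\Sigma$ with $x_j\prec y_{j+1}$ and consecutive pairs distinct; it *flows* from $m$ to $m'$ if $m\prec y_1$ and $x_J\prec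 m'$. Its coindex is $F_\gamma=(-F_{x_Jy_J}^{-1})F_{x_{J-1}y_J}\cdots F_{x_1y_2}(-F_{x_1y_1}^{-1})$. The *Morse parametrization* $F^\Sigma$ has the modules $F(m)$, $m$ critical, and the maps $$F^\Sigma_{mm'}=F_{mm'}+\sum_{\gamma}F_{x_Jm'}\circ F_\gamma\circ F_{my_1},$$ the sum being over all gradient paths $\gamma$ flowing from $m$ to $m'$. It lives over the poset of critical elements in which $m'$ covers $m$ iff $m\prec m'$ or some gradient path flows from $m$ to $m'$. **The algorithm Scythe.** While there are non-critical elements: select any minimal non-critical element $c$, mark it critical, and set a queue to $(c)$; while the queue is nonempty, dequeue $y$; if $y_-$ contains exactly one non-critical element $x$, and $F_{xy}$ is invertible, enqueue $x_+\setminus\{y\}$ and call ReducePair$(x,y)$; in any case enqueue $y_+$. Only non-critical elements of dimension $\dim c+1$ that have not been enqueued since the last reset of the queue are enqueued. ReducePair$(x,y)$: for all $z\in x_+\setminus\{y\}$ and $w\in y_-\setminus\{x\}$ set $w\prec z$ and replace $F_{wz}$ by $F_{wz}-F_{xz}F_{xy}^{-1}F_{wy}$; then remove $x$ and $y$ from $X$.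 **Cost model.** Scythe runs on a unit-cost random access machine whose cells hold indices or elements of $R$. The input is given by the list of elements, the lists $x_+$, $x_-$ (in any order), the dimensions and ranks, and the matrices of the $F_{xy}$. Matrix products and inverses (with the test for invertibility) are computed by arithmetic programs over $R$ (ring operations, inversion of units, zero tests, unit cost). Let $\omega$ be such that these programs multiply and invert matrices of size at most $e$ in $O(e^\omega)$ steps, for all $e\ge1$. **Theorem.** For every input, Scythe terminates, and the set $\Sigma$ of pairs $(x,y)$ for which ReducePair is called is an $F$-compatible acyclic matching on $X$. On termination the remaining elements are exactly the critical elements of $\Sigma$, the stored covering relation and matrices are those of the Morse parametrization $F^\Sigma$, and $F^\Sigma$ is a parametrized cochain complex over the graded poset of critical elements. Moreover let $n=|X|$, $p=\max_x|x_+|$, $d=\max_x\operatorname{rank}F(x)$, and $\tilde m=\sum_k m_k^2$, where $m_k$ is the number of critical elements of dimension $k$. There is a constant $C$, depending only on $R$, on the matrix programs and on $\omega$, such that whenever $p\ge1$ and $d\ge1$ the running time is at most $C\,n\,p\,\tilde m\,d^{\omega}$ and the memory used, not counting the internal registers of the matrix programs, is at most $C\,n^2p\,d^2$. If the matrix programs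 use at most $We^2$ registers on matrices of size at most $e$, then the total memory is at most $(C+W)\,n^2p\,d^2$. -/

import Mathlib

universe u v w

noncomputable section

namespace Scythe

/-! ### Parametrized cochain complexes, matchings and Morse data -/

/-- A family of `R`-modules indexed by `X` together with a linear map (a "block") for every
ordered pair of indices. -/
structure BlockData (R : Type u) [Ring R] (X : Type v) where
  obj : X → Type w
  [addCommGroup : ∀ x, AddCommGroup (obj x)]
  [module : ∀ x, Module R (obj x)]
  map : ∀ x y, obj x →ₗ[R] obj y

attribute [instance] BlockData.addCommGroup BlockData.module

/-- The cochain module `Cⁿ = ⨁_{dim x = n} F(x)` (a finite direct sum, written as a product). -/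
abbrev BlockData.Cochain {R : Type u} [Ring R] {X : Type v} (G : BlockData.{u, v, w} R X)
    (dim : X → ℕ) (n : ℕ) : Type (max v w) :=
  ∀ x : {x : X // dim x = n}, G.obj x.1

/-- The operator `dⁿ : Cⁿ → Cⁿ⁺¹` whose block from `F(x)` to `F(y)` is `F_{xy}`. -/
def BlockData.coboundary {R : Type u} [Ring R] {X : Type v} [Finite X]
    (G : BlockData.{u, v, w} R X) (dim : X → ℕ) (n : ℕ) :
    G.Cochain dim n →ₗ[R] G.Cochain dim (n + 1) :=
  letI : Fintype {x : X // dim x = n} := Fintype.ofFinite _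
  LinearMap.pi fun y => ∑ x : {x : X // dim x = n}, G.map x.1 y.1 ∘ₗ LinearMap.proj x

/-- The blocks assemble to a cochain complex: `dⁿ⁺¹ ∘ dⁿ = 0`. -/
def BlockData.IsCochainComplex {R : Type u} [Ring R] {X : Type v} [Finite X]
    (G : BlockData.{u, v, w} R X) (dim : X → ℕ) : Prop :=
  ∀ n, G.coboundary dim (n + 1) ∘ₗ G.coboundary dim n = 0

/-- A cochain complex of `R`-modules parametrized over the finite poset `X` with dimension
function `dim`. -/
structure Parametrization (R : Type u) [Ring R] (X : Type v) [PartialOrder X] [Finite X]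
    (dim : X → ℕ) extends BlockData.{u, v, w} R X where
  map_eq_zero : ∀ x y, ¬ x ⋖ y → map x y = 0
  isCochainComplex : toBlockData.IsCochainComplex dim

section Matching

variable {R : Type u} [Ring R] {X : Type v} [PartialOrder X]

/-- Partial matchings: every pair is a covering pair, and no element lies in two pairs. -/
structure IsPartialMatching (S : Set (X × X)) : Prop where
  dimension : ∀ p ∈ S, p.1 ⋖ p.2
  partition : ∀ p ∈ S, ∀ q ∈ S, p ≠ q → p.1 ≠ q.1 ∧ p.1 ≠ q.2 ∧ p.2 ≠ q.1 ∧ p.2 ≠ q.2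

/-- The relation `(x, y) ⊲ (x', y') ↔ x ≺ y'` on the pairs of `S`. -/
def Lhd (S : Set (X × X)) (p q : X × X) : Prop := p ∈ S ∧ q ∈ S ∧ p.1 ⋖ q.2

/-- Acyclic matchings: the transitive closure of `⊲` (which is reflexive on `S`) is
antisymmetric, hence a partial order. -/
structure IsAcyclicMatching (S : Set (X × X)) : Prop extends IsPartialMatching S where
  acyclic : ∀ p q, Relation.TransGen (Lhd S) p q → Relation.TransGen (Lhd S) q p → p = q

/-- Compatibility with the blocks: `F_{xy}` is invertible for every matched pair `(x, y)`. -/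
def IsCompatible (G : BlockData.{u, v, w} R X) (S : Set (X × X)) : Prop :=
  ∀ p ∈ S, Function.Bijective (G.map p.1 p.2)

/-- Critical, i.e. unpaired, elements. -/
def IsCritical (S : Set (X × X)) (m : X) : Prop := ∀ z, (m, z) ∉ S ∧ (z, m) ∉ S

/-- The inverse of a bijective linear map (and `0` for other maps). -/
def linInv {M N : Type w} [AddCommGroup M] [Module R M] [AddCommGroup N] [Module R N]
    (f : M →ₗ[R] N) : N →ₗ[R] M :=
  open Classical in
  if h : Function.Bijective f then ((LinearEquiv.ofBijective f h).symm : N →ₗ[R] M) else 0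

/-- The nonempty sequence of pairs `p, l₁, l₂, …` is a gradient path
`y₁ ≻ x₁ ≺ y₂ ≻ x₂ ≺ ⋯ ≺ y_J ≻ x_J`, strictly increasing for `⊲`. -/
def IsGradientPath (S : Set (X × X)) (p : X × X) (l : List (X × X)) : Prop :=
  (∀ q ∈ p :: l, q ∈ S) ∧ List.IsChain (fun a b : X × X => a ≠ b ∧ a.1 ⋖ b.2) (p :: l)

/-- The last pair of the sequence `p, l₁, l₂, …`. -/
def lastPair (p : X × X) : List (X × X) → X × X
  | [] => p
  | q :: l => lastPair q l

/-- The coindex `F_γ : F(y₁) → F(x_J)` of the path `γ = p, l₁, l₂, …`. -/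
def coindex (G : BlockData.{u, v, w} R X) (p : X × X) :
    (l : List (X × X)) → (G.obj p.2 →ₗ[R] G.obj (lastPair p l).1)
  | [] => -linInv (G.map p.1 p.2)
  | q :: l => coindex G q l ∘ₗ G.map p.1 q.2 ∘ₗ (-linInv (G.map p.1 p.2))

/-- The path `p, l₁, l₂, …` is a gradient path flowing from `m` to `m'`. -/
def FlowsFromTo (S : Set (X × X)) (m m' : X) (p : X × X) (l : List (X × X)) : Prop :=
  IsGradientPath S p l ∧ m ⋖ p.2 ∧ (lastPair p l).1 ⋖ m'

/-- `F^Σ_{mm'}`: the block `F_{mm'}` plus the contributions of all gradient paths flowing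
from `m` to `m'`. For an acyclic matching there are finitely many such paths. -/
def morseMap (G : BlockData.{u, v, w} R X) (S : Set (X × X)) (m m' : X) :
    G.obj m →ₗ[R] G.obj m' :=
  G.map m m' + ∑ᶠ (γ : (X × X) × List (X × X)) (_ : FlowsFromTo S m m' γ.1 γ.2),
    G.map (lastPair γ.1 γ.2).1 m' ∘ₗ coindex G γ.1 γ.2 ∘ₗ G.map m γ.1.2

/-- The Morse data `F^Σ`, indexed by the critical elements. -/
def morseData (G : BlockData.{u, v, w} R X) (S : Set (X × X)) :
    BlockData.{u, v, w} R {m : X // IsCritical S m} where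
  obj m := G.obj m.1
  map m m' := morseMap G S m.1 m'.1

/-- The covering relation of the poset of critical elements: `m ≺ m'` held already, or some
gradient path flows from `m` to `m'`. -/
def MorseCovers (S : Set (X × X)) (m m' : X) : Prop :=
  m ⋖ m' ∨ ∃ p l, FlowsFromTo S m m' p l

/-- The order `≤_Σ` on critical elements generated by `MorseCovers`. -/
def MorseLE (S : Set (X × X)) (m m' : {m : X // IsCritical S m}) : Prop :=
  Relation.ReflTransGen (fun a b : {m : X // IsCritical S m} => MorseCovers S a.1 b.1) m m'

end Matching

/-! ### Arithmetic programs over `R` and matrix arithmetic -/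

/-- Arithmetic programs (algebraic computation trees) over the ring `R` with `s` registers.
Program text refers to ring elements only through registers. Each instruction takes one step. -/
inductive Prog (R : Type u) (s : ℕ) : Type u
  /-- stop and output the contents of the listed registers -/
  | ret (out : List (Fin s)) : Prog R s
  /-- stop and report failure -/
  | fail : Prog R s
  | const (dst : Fin s) (a : R) (k : Prog R s) : Prog R s
  | add (dst i j : Fin s) (k : Prog R s) : Prog R s
  | sub (dst i j : Fin s) (k : Prog R s) : Prog R s
  | mul (dst i j : Fin s) (k : Prog R s) : Prog R s
  /-- if register `i` holds a unit, write its inverse to `dst` and go to `k`, else go to `k'` -/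
  | inv (dst i : Fin s) (k k' : Prog R s) : Prog R s
  /-- if register `i` holds `0`, go to `k`, else go to `k'` -/
  | ifZero (i : Fin s) (k k' : Prog R s) : Prog R s

namespace Prog

variable {R : Type u} {s : ℕ}

/-- Running a program on a register content. -/
def eval [Ring R] : Prog R s → (Fin s → R) → Option (List R)
  | ret out, m => some (out.map m)
  | fail, _ => none
  | const dst a k, m => k.eval (Function.update m dst a)
  | add dst i j k, m => k.eval (Function.update m dst (m i + m j))
  | sub dst i j k, m => k.eval (Function.update m dst (m i - m j))
  | mul dst i j k, m => k.eval (Function.update m dst (m i * m j))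
  | inv dst i k k', m =>
      open Classical in
      if IsUnit (m i) then k.eval (Function.update m dst (Ring.inverse (m i))) else k'.eval m
  | ifZero i k k', m =>
      open Classical in
      if m i = 0 then k.eval m else k'.eval m

/-- Worst-case number of steps; writing an output takes one step per entry. -/
def cost : Prog R s → ℕ
  | ret out => out.length + 1
  | fail => 1
  | const _ _ k => k.cost + 1
  | add _ _ _ k => k.cost + 1
  | sub _ _ _ k => k.cost + 1
  | mul _ _ _ k => k.cost + 1
  | inv _ _ k k' => max k.cost k'.cost + 1
  | ifZero _ k k' => max k.cost k'.cost + 1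

/-- Running a program on an input list, which is placed in the first registers; the other
registers hold `0`. -/
def run [Ring R] (P : Prog R s) (input : List R) : Option (List R) :=
  P.eval fun i => input.getD i 0

end Prog

section Entries

variable {R : Type u}

/-- The entries of a matrix, row by row. -/
def entries {a b : ℕ} (A : Matrix (Fin a) (Fin b) R) : List R :=
  (List.ofFn fun i => List.ofFn fun j => A i j).flatten

/-- The upper left `a × b` block of the matrix with rows of length `c` listed in `l`. -/
def ofEntries [Zero R] (a b c : ℕ) (l : List R) : Matrix (Fin a) (Fin b) R :=
  Matrix.of fun i j => l.getD (i * c + j) 0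

/-- Padding with zeros to an `e × e` matrix. -/
def pad [Zero R] {a b : ℕ} (e : ℕ) (A : Matrix (Fin a) (Fin b) R) : Matrix (Fin e) (Fin e) R :=
  Matrix.of fun i j => if h : i.1 < a ∧ j.1 < b then A ⟨i, h.1⟩ ⟨j, h.2⟩ else 0

end Entries

/-- The matrix arithmetic used by the algorithm: for every `e` a program that multiplies
two `e × e` matrices over `R`, and for all `a, b` a program that decides whether an `a × b`
matrix is invertible and outputs its inverse if it is. -/
structure MatrixKit (R : Type u) [Ring R] where
  mulRegs : ℕ → ℕ
  mul : ∀ e, Prog R (mulRegs e)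
  mul_run : ∀ e (A B : Matrix (Fin e) (Fin e) R),
    (mul e).run (entries A ++ entries B) = some (entries (A * B))
  invRegs : ℕ → ℕ → ℕ
  inv : ∀ a b, Prog R (invRegs a b)
  inv_run_some : ∀ a b (A : Matrix (Fin a) (Fin b) R) (B : Matrix (Fin b) (Fin a) R),
    A * B = 1 → B * A = 1 → (inv a b).run (entries A) = some (entries B)
  inv_run_none : ∀ a b (A : Matrix (Fin a) (Fin b) R),
    (¬ ∃ B : Matrix (Fin b) (Fin a) R, A * B = 1 ∧ B * A = 1) →
      (inv a b).run (entries A) = none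

namespace MatrixKit

variable {R : Type u} [Ring R] (kit : MatrixKit R)

/-- Multiplication and inversion of matrices of size at most `e` take `O(e ^ ω)` steps. -/
def HasExponent (ω : ℝ) : Prop :=
  ∃ K : ℝ, ∀ e : ℕ, 1 ≤ e → ((kit.mul e).cost : ℝ) ≤ K * (e : ℝ) ^ ω ∧
    ∀ a b, a ≤ e → b ≤ e → ((kit.inv a b).cost : ℝ) ≤ K * (e : ℝ) ^ ω

/-- Multiplication and inversion of matrices of size at most `e` use at most `W * e ^ 2`
registers. -/
def HasWorkspace (W : ℕ) : Prop :=
  ∀ e : ℕ, 1 ≤ e → kit.mulRegs e ≤ W * e ^ 2 ∧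
    ∀ a b, a ≤ e → b ≤ e → kit.invRegs a b ≤ W * e ^ 2

/-- The size at which a rectangular product is computed. -/
def mulSize (a b c : ℕ) : ℕ := max a (max b c)

/-- Rectangular product: pad with zeros, run the square program, cut out the result. -/
def mulRect {a b c : ℕ} (A : Matrix (Fin a) (Fin b) R) (B : Matrix (Fin b) (Fin c) R) :
    Matrix (Fin a) (Fin c) R :=
  let e := mulSize a b c
  ofEntries a c e (((kit.mul e).run (entries (pad e A) ++ entries (pad e B))).getD [])

/-- Steps of `mulRect`: load the padded factors, run the program, copy the result. -/
def mulTime (a b c : ℕ) : ℕ :=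
  2 * mulSize a b c ^ 2 + (kit.mul (mulSize a b c)).cost + a * c

/-- Inversion test and inverse of an `a × b` matrix. -/
def invRect {a b : ℕ} (A : Matrix (Fin a) (Fin b) R) : Option (Matrix (Fin b) (Fin a) R) :=
  ((kit.inv a b).run (entries A)).map (ofEntries b a a)

/-- Steps of `invRect`: load the matrix, run the program, copy the result. -/
def invTime (a b : ℕ) : ℕ := a * b + (kit.inv a b).cost + b * a

end MatrixKit

/-! ### Input -/

/-- `p`, the maximal number of covers of an element. -/
def maxCovers (X : Type v) [PartialOrder X] [Fintype X] : ℕ :=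
  Finset.univ.sup fun x : X => Set.ncard {y : X | x ⋖ y}

/-- An input: a finite graded poset `X`, given by a list of its elements and the lists
`x₊` and `x₋` of covers and of covered elements (each in an arbitrary order), and a cochain
complex of free `R`-modules parametrized over `X`, given by a basis of each `F(x)`. -/
structure Input (R : Type u) [Ring R] (X : Type v) [PartialOrder X] [Finite X] where
  dim : X → ℕ
  dim_covBy : ∀ x y, x ⋖ y → dim y = dim x + 1
  F : Parametrization.{u, v, w} R X dim
  rank : X → ℕ
  basis : ∀ x, Module.Basis (Fin (rank x)) R (F.obj x)
  elems : List X
  nodup_elems : elems.Nodup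
  mem_elems : ∀ x, x ∈ elems
  up : X → List X
  nodup_up : ∀ x, (up x).Nodup
  mem_up : ∀ x y, y ∈ up x ↔ x ⋖ y
  down : X → List X
  nodup_down : ∀ y, (down y).Nodup
  mem_down : ∀ x y, x ∈ down y ↔ x ⋖ y

namespace Input

variable {R : Type u} [Ring R] {X : Type v} [PartialOrder X] [Fintype X]
  (I : Input.{u, v, w} R X)

/-- The matrix of a linear map `F(x) → F(y)`: row `i` holds the coordinates of the image of the
`i`-th basis vector. With this convention `g ∘ f` has the matrix `[f] * [g]`, also over
noncommutative rings. -/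
def matrixOf {x y : X} (f : I.F.obj x →ₗ[R] I.F.obj y) :
    Matrix (Fin (I.rank x)) (Fin (I.rank y)) R :=
  Matrix.of fun i j => (I.basis y).repr (f (I.basis x i)) j

/-- `d`, the maximal rank of a module `F(x)`. -/
def maxRank : ℕ := Finset.univ.sup I.rank

/-- `m̃ = ∑ₖ mₖ²`, where `mₖ` is the number of critical elements of dimension `k`. -/
def critSq (S : Set (X × X)) : ℕ :=
  ∑ k ∈ Finset.univ.image I.dim, Set.ncard {x : X | IsCritical S x ∧ I.dim x = k} ^ 2

end Input

/-! ### The algorithm -/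

/-- The memory of the algorithm, together with counters for the time used so far, the peak
memory used so far, and the peak number of registers used inside matrix subroutines. -/
structure Store (R : Type u) (X : Type v) (rank : X → ℕ) where
  /-- has not been removed from `X` -/
  alive : X → Bool
  /-- has been marked as critical -/
  crit : X → Bool
  /-- has been enqueued since the queue was last reinitialized -/
  queued : X → Bool
  /-- the number of non-critical elements of `x₋` -/
  cnt : X → ℕ
  /-- the list of `x₊`; removed elements may remain in it -/
  up : X → List X
  /-- the list of `x₋`; removed elements may remain in it -/
  down : X → List X
  /-- the matrix of `F_{xy}`, stored if `x ≺ y` -/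
  blk : ∀ x y, Option (Matrix (Fin (rank x)) (Fin (rank y)) R)
  queue : List X
  /-- the pairs for which `ReducePair` has been called -/
  pairs : List (X × X)
  time : ℕ
  mem : ℕ
  work : ℕ

namespace Store

variable {R : Type u} {X : Type v} {rank : X → ℕ}

/-- The number of memory cells occupied: for each `x` a cell for the list of elements, the
dimension, the rank, the three flags, the counter, and the heads and the tails of the two
adjacency lists; two cells for each list node; a table of pointers indexed by `X × X` and one
cell for each entry of a stored matrix; the queue, the list of pairs and the loop variables. -/
def size [Fintype X] (s : Store R X rank) : ℕ :=
  (∑ x, (11 + 2 * (s.up x).length + 2 * (s.down x).length)) +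
  (∑ x, ∑ y, (1 + if (s.blk x y).isSome then rank x * rank y else 0)) +
  2 * s.queue.length + 3 * s.pairs.length + 10

/-- Account for `t` steps, during which `extra` cells are used for temporary data. -/
def charge [Fintype X] (s : Store R X rank) (t extra : ℕ) : Store R X rank :=
  { s with time := s.time + t, mem := max s.mem (s.size + extra) }

/-- Account for the use of `regs` registers by a matrix subroutine. -/
def useWork (s : Store R X rank) (regs : ℕ) : Store R X rank :=
  { s with work := max s.work regs }

variable [Fintype X] [DecidableEq X]

/-- Lower the counter of each element of a list by one. -/
def decr (l : List X) (s : Store R X rank) : Store R X rank :=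
  l.foldl (fun s z => ({ s with cnt := Function.update s.cnt z (s.cnt z - 1) }).charge 1 0) s

/-- Mark `c` as critical. -/
def mark (c : X) (s : Store R X rank) : Store R X rank :=
  decr (s.up c) (({ s with crit := Function.update s.crit c true }).charge 1 0)

/-- Remove `x` (which is not critical) from `X`. -/
def remove (x : X) (s : Store R X rank) : Store R X rank :=
  decr (s.up x) (({ s with alive := Function.update s.alive x false }).charge 1 0)

/-- Set the queue to `[c]`, clear all other flags. -/
def resetQueue (c : X) (s : Store R X rank) : Store R X rank :=
  ({ s with
      queue := [c]
      queued := Function.update (fun _ => false) c true }).charge (Fintype.card X + 2) 0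

/-- Enqueue those elements of a list which are present, are not critical, have not been enqueued
since the last reset and have dimension `k + 1`. -/
def enqueue (dim : X → ℕ) (k : ℕ) (l : List X) (s : Store R X rank) : Store R X rank :=
  l.foldl (fun s z =>
    if s.alive z && !s.crit z && !s.queued z && decide (dim z = k + 1) then
      ({ s with queue := s.queue ++ [z], queued := Function.update s.queued z true }).charge 1 0
    else s.charge 1 0) s

/-- Set `w ≺ z`. -/
def setCover (w z : X) (s : Store R X rank) : Store R X rank :=
  if (s.blk w z).isSome then s
  else
    { s with
      up := Function.update s.up w (s.up w ++ [z])
      down := Function.update s.down z (s.down z ++ [w]) }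

/-- Store a matrix as `F_{wz}`. -/
def setBlk (w z : X) (A : Matrix (Fin (rank w)) (Fin (rank z)) R) (s : Store R X rank) :
    Store R X rank :=
  { s with blk := Function.update s.blk w (Function.update (s.blk w) z (some A)) }

variable [Ring R]

/-- The matrix `F_{xy}`, which is `0` if nothing is stored. -/
def getBlk (s : Store R X rank) (x y : X) : Matrix (Fin (rank x)) (Fin (rank y)) R :=
  (s.blk x y).getD 0

/-- Set `w ≺ z` and replace `F_{wz}` by `F_{wz} - F_{xz} ∘ F_{xy}⁻¹ ∘ F_{wy}`, where `B` is the
matrix of `F_{xy}⁻¹`. The caller holds `extra` cells of temporary data. -/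
def updateBlk (kit : MatrixKit R) (x y : X) (B : Matrix (Fin (rank y)) (Fin (rank x)) R)
    (extra : ℕ) (z w : X) (s : Store R X rank) : Store R X rank :=
  let P := kit.mulRect (s.getBlk w y) B
  let Q := kit.mulRect P (s.getBlk x z)
  let e₁ := MatrixKit.mulSize (rank w) (rank y) (rank x)
  let e₂ := MatrixKit.mulSize (rank w) (rank x) (rank z)
  let s := (s.useWork (kit.mulRegs e₁)).useWork (kit.mulRegs e₂)
  (setBlk w z (s.getBlk w z - Q) (setCover w z s)).charge
    (kit.mulTime (rank w) (rank y) (rank x) + kit.mulTime (rank w) (rank x) (rank z)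
      + rank w * rank z + 3)
    (extra + rank w * rank x + rank w * rank z + 2 * e₁ ^ 2 + 2 * e₂ ^ 2)

/-- `ReducePair(x, y)`; `low` lists the present elements of `y₋`, and `B` is the matrix of
`F_{xy}⁻¹`. -/
def reducePair (kit : MatrixKit R) (x y : X) (B : Matrix (Fin (rank y)) (Fin (rank x)) R)
    (low : List X) (s : Store R X rank) : Store R X rank :=
  let zs := (s.up x).filter fun z => s.alive z && decide (z ≠ y)
  let ws := low.filter fun w => decide (w ≠ x)
  let extra := 2 * zs.length + 2 * ws.length + 2 * low.length + rank y * rank x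
  let s := s.charge ((s.up x).length + low.length + 1) extra
  let s := zs.foldl (fun s z =>
    ws.foldl (fun s w => updateBlk kit x y B extra z w s) (s.charge 1 extra)) s
  let s := remove y (remove x s)
  ({ s with pairs := (x, y) :: s.pairs }).charge 1 0

/-- One pass of the inner loop for the element `y`, which has just been dequeued: if exactly one
element `x` of `y₋` is not critical, and `F_{xy}` is invertible, then enqueue `x₊ \ {y}` (`y`
itself carries a flag and is not enqueued again) and call `ReducePair(x, y)`. In any case enqueue
`y₊`. -/
def process (kit : MatrixKit R) (dim : X → ℕ) (k : ℕ) (y : X) (s : Store R X rank) :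
    Store R X rank :=
  let low := (s.down y).filter fun x => s.alive x
  let nonCrit := low.filter fun x => !s.crit x
  let extra := 2 * low.length + 2 * nonCrit.length
  let s := s.charge ((s.down y).length + low.length + 1) extra
  let s :=
    match nonCrit with
    | [x] =>
      let s := (s.useWork (kit.invRegs (rank x) (rank y))).charge
        (kit.invTime (rank x) (rank y)) (extra + 2 * (rank x * rank y))
      match kit.invRect (s.getBlk x y) with
      | some B => reducePair kit x y B low (enqueue dim k (s.up x) s)
      | none => s
    | _ => s
  enqueue dim k (s.up y) s

/-- The inner loop. The first argument bounds the number of passes; the result is `none` if the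
loop has not ended within this bound. -/
def innerLoop (kit : MatrixKit R) (dim : X → ℕ) (k : ℕ) :
    ℕ → Store R X rank → Option (Store R X rank)
  | 0, _ => none
  | N + 1, s =>
    match s.queue with
    | [] => some (s.charge 1 0)
    | y :: q => innerLoop kit dim k N (process kit dim k y (({ s with queue := q }).charge 1 0))

/-- The outer loop, with the same convention. Scan the list of elements for a minimal
non-critical element `c`; if there is none, stop, otherwise mark `c` as critical and run the
inner loop from `c`. -/
def outerLoop (kit : MatrixKit R) (dim : X → ℕ) (elems : List X) (M : ℕ) :
    ℕ → Store R X rank → Option (Store R X rank)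
  | 0, _ => none
  | N + 1, s =>
    let s := s.charge (elems.length + 1) 0
    match elems.find? fun x => s.alive x && !s.crit x && decide (s.cnt x = 0) with
    | none => some s
    | some c =>
      (innerLoop kit dim (dim c) M (resetQueue c (mark c s))).bind (outerLoop kit dim elems M N)

end Store

namespace Input

variable {R : Type u} [Ring R] {X : Type v} [PartialOrder X] [Fintype X] [DecidableEq X]
  (I : Input.{u, v, w} R X)

/-- The memory at the start, holding the input. -/
def load : Store R X I.rank where
  alive _ := true
  crit _ := false
  queued _ := false
  cnt _ := 0
  up := I.up
  down := I.down
  blk x y := open Classical in if x ⋖ y then some (I.matrixOf (I.F.map x y)) else none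
  queue := []
  pairs := []
  time := 0
  mem := 0
  work := 0

/-- Initialize the counters: at first all elements of `x₋` are non-critical. -/
def initCounters (s : Store R X I.rank) : Store R X I.rank :=
  I.elems.foldl (fun s x =>
    ({ s with cnt := Function.update s.cnt x (s.down x).length }).charge
      ((s.down x).length + 1) 0) (s.charge 0 0)

/-- The algorithm `Scythe`, run with at most `N` passes of each loop; the result is `none` if
it has not terminated within this bound. -/
def scythe (kit : MatrixKit R) (N : ℕ) : Option (Store R X I.rank) :=
  Store.outerLoop kit I.dim I.elems N N (I.initCounters I.load)

end Input

end Scythe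

end

open Scythe

set_option linter.unusedSectionVars false

noncomputable section

namespace Scythe

/-! ### Gradient paths and Morse data of a matching with one more pair -/

section GradientPaths

variable {R : Type u} [Ring R] {X : Type v} [PartialOrder X]

theorem isGradientPath_nil {S : Set (X × X)} {p : X × X} : IsGradientPath S p [] ↔ p ∈ S := by
  simp [IsGradientPath]

theorem isGradientPath_cons {S : Set (X × X)} {p q : X × X} {l : List (X × X)} :
    IsGradientPath S p (q :: l) ↔ p ∈ S ∧ p ≠ q ∧ p.1 ⋖ q.2 ∧ IsGradientPath S q l := by
  simp only [IsGradientPath, List.mem_cons, List.isChain_cons_cons, forall_eq_or_imp]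
  tauto

theorem IsGradientPath.lastPair_mem {S : Set (X × X)} {p : X × X} {l : List (X × X)}
    (h : IsGradientPath S p l) : lastPair p l ∈ S := by
  induction l generalizing p with
  | nil => exact isGradientPath_nil.1 h
  | cons q l ih => exact ih (isGradientPath_cons.1 h).2.2.2

theorem IsGradientPath.head_mem {S : Set (X × X)} {p : X × X} {l : List (X × X)}
    (h : IsGradientPath S p l) : p ∈ S := h.1 p (by simp)

theorem lastPair_concat {X : Type v} (p q : X × X) (l : List (X × X)) : lastPair p (l ++ [q]) = q := by
  induction l generalizing p with
  | nil => rfl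
  | cons r l ih => exact ih r

theorem IsGradientPath.mono {S T : Set (X × X)} (hST : S ⊆ T) {p : X × X} {l : List (X × X)}
    (h : IsGradientPath S p l) : IsGradientPath T p l :=
  ⟨fun q hq => hST (h.1 q hq), h.2⟩

theorem IsGradientPath.concat {S : Set (X × X)} {p q : X × X} {l : List (X × X)}
    (h : IsGradientPath S p l) (hq : q ∉ S) (hl : (lastPair p l).1 ⋖ q.2) :
    IsGradientPath (insert q S) p (l ++ [q]) := by
  induction l generalizing p with
  | nil =>
    have hp := isGradientPath_nil.1 h
    refine isGradientPath_cons.2 ⟨Or.inr hp, ?_, hl, isGradientPath_nil.2 (Or.inl rfl)⟩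
    rintro rfl; exact hq hp
  | cons r l ih =>
    obtain ⟨h1, h2, h3, h4⟩ := isGradientPath_cons.1 h
    exact isGradientPath_cons.2 ⟨Or.inr h1, h2, h3, ih h4 hl⟩

/-- If no pair of `S` can follow `q`, then `q` can only occur at the end of a gradient path. -/
theorem IsGradientPath.of_insert {S : Set (X × X)} {q : X × X}
    (hfree : ∀ r ∈ S, ¬ q.1 ⋖ r.2) {p : X × X} {l : List (X × X)}
    (h : IsGradientPath (insert q S) p l) :
    IsGradientPath S p l ∨ (p = q ∧ l = []) ∨
      ∃ l', l = l' ++ [q] ∧ IsGradientPath S p l' ∧ (lastPair p l').1 ⋖ q.2 := by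
  induction l generalizing p with
  | nil =>
    rcases isGradientPath_nil.1 h with rfl | hp
    · exact Or.inr (Or.inl ⟨rfl, rfl⟩)
    · exact Or.inl (isGradientPath_nil.2 hp)
  | cons r l ih =>
    obtain ⟨h1, h2, h3, h4⟩ := isGradientPath_cons.1 h
    rcases h1 with rfl | hp
    · rcases h4.head_mem with hr | hr
      · exact absurd hr.symm h2
      · exact absurd h3 (hfree r hr)
    · rcases ih h4 with h5 | ⟨rfl, rfl⟩ | ⟨l', rfl, h5, h6⟩
      · exact Or.inl (isGradientPath_cons.2 ⟨hp, h2, h3, h5⟩)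
      · exact Or.inr (Or.inr ⟨[], rfl, isGradientPath_nil.2 hp, h3⟩)
      · exact Or.inr (Or.inr ⟨r :: l', rfl, isGradientPath_cons.2 ⟨hp, h2, h3, h5⟩, h6⟩)

theorem flowsFromTo_insert {S : Set (X × X)} {q : X × X} (hq : q ∉ S)
    (hfree : ∀ r ∈ S, ¬ q.1 ⋖ r.2) {m m' : X} {p : X × X} {l : List (X × X)} :
    FlowsFromTo (insert q S) m m' p l ↔ FlowsFromTo S m m' p l ∨
      (q.1 ⋖ m' ∧ ((p = q ∧ l = [] ∧ m ⋖ q.2) ∨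
        ∃ l', l = l' ++ [q] ∧ FlowsFromTo S m q.2 p l')) := by
  constructor
  · rintro ⟨h1, h2, h3⟩
    rcases h1.of_insert hfree with h | ⟨rfl, rfl⟩ | ⟨l', rfl, h5, h6⟩
    · exact Or.inl ⟨h, h2, h3⟩
    · exact Or.inr ⟨h3, Or.inl ⟨rfl, rfl, h2⟩⟩
    · rw [lastPair_concat] at h3
      exact Or.inr ⟨h3, Or.inr ⟨l', rfl, h5, h2, h6⟩⟩
  · rintro (⟨h1, h2, h3⟩ | ⟨h3, (⟨rfl, rfl, h2⟩ | ⟨l', rfl, h5, h2, h6⟩)⟩)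
    · exact ⟨h1.mono (Set.subset_insert _ _), h2, h3⟩
    · exact ⟨isGradientPath_nil.2 (Or.inl rfl), h2, h3⟩
    · exact ⟨h5.concat hq h6, h2, by rwa [lastPair_concat]⟩

theorem morseCovers_insert {S : Set (X × X)} {q : X × X} (hq : q ∉ S)
    (hfree : ∀ r ∈ S, ¬ q.1 ⋖ r.2) {m m' : X} :
    MorseCovers (insert q S) m m' ↔ MorseCovers S m m' ∨ (q.1 ⋖ m' ∧ MorseCovers S m q.2) := by
  simp only [MorseCovers, flowsFromTo_insert hq hfree]
  constructor
  · rintro (h | ⟨p, l, h | ⟨h, (⟨rfl, rfl, h'⟩ | ⟨l', rfl, h'⟩)⟩⟩)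
    · exact Or.inl (Or.inl h)
    · exact Or.inl (Or.inr ⟨p, l, h⟩)
    · exact Or.inr ⟨h, Or.inl h'⟩
    · exact Or.inr ⟨h, Or.inr ⟨p, l', h'⟩⟩
  · rintro ((h | ⟨p, l, h⟩) | ⟨h, (h' | ⟨p, l, h'⟩)⟩)
    · exact Or.inl h
    · exact Or.inr ⟨p, l, Or.inl h⟩
    · exact Or.inr ⟨q, [], Or.inr ⟨h, Or.inl ⟨rfl, rfl, h'⟩⟩⟩
    · exact Or.inr ⟨p, l ++ [q], Or.inr ⟨h, Or.inr ⟨l, rfl, h'⟩⟩⟩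

theorem not_flowsFromTo_of_free {S : Set (X × X)} {m : X} (hfree : ∀ r ∈ S, ¬ m ⋖ r.2)
    {m' : X} {p : X × X} {l : List (X × X)} : ¬ FlowsFromTo S m m' p l :=
  fun h => hfree p h.1.head_mem h.2.1

theorem morseCovers_of_free {S : Set (X × X)} {m : X} (hfree : ∀ r ∈ S, ¬ m ⋖ r.2) {m' : X} :
    MorseCovers S m m' ↔ m ⋖ m' := by
  simp [MorseCovers, not_flowsFromTo_of_free hfree]

/-- The gradient paths flowing from `m` to `m'`. -/
def flowSet (S : Set (X × X)) (m m' : X) : Set ((X × X) × List (X × X)) :=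
  {γ | FlowsFromTo S m m' γ.1 γ.2}

/-- The contribution of a gradient path to `F^Σ_{mm'}`. -/
def pathMap (G : BlockData.{u, v, w} R X) (m' : X) (p : X × X) (l : List (X × X)) :
    G.obj p.2 →ₗ[R] G.obj m' :=
  G.map (lastPair p l).1 m' ∘ₗ coindex G p l

theorem pathMap_cons {X : Type v} (G : BlockData.{u, v, w} R X) (m' : X) (p q : X × X)
    (l : List (X × X)) :
    pathMap G m' p (q :: l) =
      pathMap G m' q l ∘ₗ G.map p.1 q.2 ∘ₗ (-linInv (G.map p.1 p.2)) := rfl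

theorem pathMap_concat {X : Type v} (G : BlockData.{u, v, w} R X) (m' : X) (p q : X × X)
    (l : List (X × X)) :
    pathMap G m' p (l ++ [q]) =
      G.map q.1 m' ∘ₗ (-linInv (G.map q.1 q.2)) ∘ₗ pathMap G q.2 p l := by
  induction l generalizing p with
  | nil => rfl
  | cons r l ih =>
    rw [List.cons_append, pathMap_cons, ih, pathMap_cons]
    rfl

theorem morseMap_eq (G : BlockData.{u, v, w} R X) (S : Set (X × X)) (m m' : X) :
    morseMap G S m m' = G.map m m' +
      ∑ᶠ γ ∈ flowSet S m m', pathMap G m' γ.1 γ.2 ∘ₗ G.map m γ.1.2 := rfl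

theorem morseMap_of_free (G : BlockData.{u, v, w} R X) {S : Set (X × X)} {m : X}
    (hfree : ∀ r ∈ S, ¬ m ⋖ r.2) (m' : X) : morseMap G S m m' = G.map m m' := by
  have : flowSet S m m' = ∅ :=
    Set.eq_empty_of_forall_notMem fun γ h => not_flowsFromTo_of_free hfree h
  rw [morseMap_eq, this, finsum_mem_empty, add_zero]

theorem flowSet_insert {S : Set (X × X)} {q : X × X} (hq : q ∉ S)
    (hfree : ∀ r ∈ S, ¬ q.1 ⋖ r.2) (m m' : X) :
    flowSet (insert q S) m m' = flowSet S m m' ∪ {γ | q.1 ⋖ m' ∧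
      (γ ∈ {γ | γ = (q, []) ∧ m ⋖ q.2} ∪
        (fun γ : (X × X) × List (X × X) => (γ.1, γ.2 ++ [q])) '' flowSet S m q.2)} := by
  ext ⟨p, l⟩
  simp only [flowSet, Set.mem_ofPred_eq, flowsFromTo_insert hq hfree, Set.mem_union, Set.mem_image,
    Prod.mk.injEq]
  refine or_congr Iff.rfl (and_congr Iff.rfl (or_congr (and_assoc.symm) ?_))
  constructor
  · rintro ⟨l', rfl, h⟩; exact ⟨(p, l'), h, rfl, rfl⟩
  · rintro ⟨⟨p', l'⟩, h, rfl, rfl⟩; exact ⟨l', rfl, h⟩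

theorem flowSet_insert_finite {S : Set (X × X)} {q : X × X} (hq : q ∉ S)
    (hfree : ∀ r ∈ S, ¬ q.1 ⋖ r.2) (hfin : ∀ m m', (flowSet S m m').Finite) (m m' : X) :
    (flowSet (insert q S) m m').Finite := by
  rw [flowSet_insert hq hfree]
  refine (hfin m m').union (Set.Finite.subset (Set.Finite.union (Set.finite_singleton (q, []))
    ((hfin m q.2).image fun γ : (X × X) × List (X × X) => (γ.1, γ.2 ++ [q]))) ?_)
  rintro γ ⟨-, (⟨h, -⟩ | h)⟩
  · exact Or.inl h
  · exact Or.inr h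

/-- Composition with a fixed linear map commutes with finite sums. -/
theorem comp_finsum_mem {ι : Type*} {M N P : Type*} [AddCommGroup M] [AddCommGroup N]
    [AddCommGroup P] [Module R M] [Module R N] [Module R P] (A : N →ₗ[R] P) {s : Set ι}
    (hs : s.Finite) (f : ι → M →ₗ[R] N) :
    A ∘ₗ (∑ᶠ i ∈ s, f i) = ∑ᶠ i ∈ s, A ∘ₗ f i :=
  (AddMonoidHom.mk' (fun g : M →ₗ[R] N => A ∘ₗ g)
    (fun g h => LinearMap.comp_add g h A)).map_finsum_mem f hs

/-- Adding a pair that no pair of `S` can follow performs one step of Gaussian elimination on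
the Morse data. -/
theorem morseMap_insert (G : BlockData.{u, v, w} R X) (hG : ∀ x y, ¬ x ⋖ y → G.map x y = 0)
    {S : Set (X × X)} {q : X × X} (hq : q ∉ S) (hfree : ∀ r ∈ S, ¬ q.1 ⋖ r.2)
    (hfin : ∀ m m', (flowSet S m m').Finite) (m m' : X) :
    morseMap G (insert q S) m m' = morseMap G S m m' -
      G.map q.1 m' ∘ₗ linInv (G.map q.1 q.2) ∘ₗ morseMap G S m q.2 := by
  by_cases hm' : q.1 ⋖ m'
  swap
  · have : flowSet (insert q S) m m' = flowSet S m m' := by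
      rw [flowSet_insert hq hfree]; simp [hm']
    rw [morseMap_eq, this, hG _ _ hm', LinearMap.zero_comp, sub_zero]; rfl
  have hset : flowSet (insert q S) m m' = flowSet S m m' ∪ ({γ | γ = (q, []) ∧ m ⋖ q.2} ∪
        (fun γ : (X × X) × List (X × X) => (γ.1, γ.2 ++ [q])) '' flowSet S m q.2) := by
    rw [flowSet_insert hq hfree]; simp only [hm', true_and]; rfl
  have hlast : ∀ γ ∈ flowSet S m m', lastPair γ.1 γ.2 ≠ q := fun γ h e =>
    hq (e ▸ h.1.lastPair_mem)
  have hinj : Set.InjOn (fun γ : (X × X) × List (X × X) => (γ.1, γ.2 ++ [q]))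
      (flowSet S m q.2) := by
    rintro ⟨p, l⟩ - ⟨p', l'⟩ - h
    simpa using h
  have hfin1 : {γ : (X × X) × List (X × X) | γ = (q, []) ∧ m ⋖ q.2}.Finite :=
    (Set.finite_singleton (q, [])).subset fun γ h => h.1
  have hdisj1 : Disjoint {γ : (X × X) × List (X × X) | γ = (q, []) ∧ m ⋖ q.2}
      ((fun γ : (X × X) × List (X × X) => (γ.1, γ.2 ++ [q])) '' flowSet S m q.2) := by
    rw [Set.disjoint_left]
    rintro _ ⟨rfl, -⟩ ⟨γ, -, h⟩
    simp at h
  have hdisj2 : Disjoint (flowSet S m m') ({γ | γ = (q, []) ∧ m ⋖ q.2} ∪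
        (fun γ : (X × X) × List (X × X) => (γ.1, γ.2 ++ [q])) '' flowSet S m q.2) := by
    rw [Set.disjoint_left]
    rintro γ h (⟨rfl, -⟩ | ⟨γ', -, rfl⟩)
    · exact hlast _ h rfl
    · exact hlast _ h (lastPair_concat _ _ _)
  have hsingle : ∑ᶠ γ ∈ {γ : (X × X) × List (X × X) | γ = (q, []) ∧ m ⋖ q.2},
      pathMap G m' γ.1 γ.2 ∘ₗ G.map m γ.1.2 =
      -(G.map q.1 m' ∘ₗ linInv (G.map q.1 q.2) ∘ₗ G.map m q.2) := by
    by_cases h : m ⋖ q.2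
    · have : {γ : (X × X) × List (X × X) | γ = (q, []) ∧ m ⋖ q.2} = {(q, [])} := by
        ext γ; simp [h]
      rw [this, finsum_mem_singleton]
      ext a
      change G.map q.1 m' (-(linInv (G.map q.1 q.2) (G.map m q.2 a))) = _
      rw [map_neg]
      rfl
    · have : {γ : (X × X) × List (X × X) | γ = (q, []) ∧ m ⋖ q.2} = ∅ := by
        ext γ; simp [h]
      rw [this, finsum_mem_empty, hG _ _ h]
      simp
  have hconcat : ∑ᶠ γ ∈ (fun γ : (X × X) × List (X × X) => (γ.1, γ.2 ++ [q])) ''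
      flowSet S m q.2, pathMap G m' γ.1 γ.2 ∘ₗ G.map m γ.1.2 =
      -(G.map q.1 m' ∘ₗ linInv (G.map q.1 q.2) ∘ₗ
        ∑ᶠ γ ∈ flowSet S m q.2, pathMap G q.2 γ.1 γ.2 ∘ₗ G.map m γ.1.2) := by
    rw [finsum_mem_image hinj, ← LinearMap.comp_assoc, ← LinearMap.neg_comp,
      comp_finsum_mem _ (hfin m q.2)]
    refine finsum_mem_congr rfl fun γ _ => ?_
    rw [pathMap_concat]
    ext a
    simp
  rw [morseMap_eq, morseMap_eq, morseMap_eq, hset,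
    finsum_mem_union hdisj2 (hfin m m') (hfin1.union ((hfin m q.2).image _)),
    finsum_mem_union hdisj1 hfin1 ((hfin m q.2).image _), hsingle, hconcat]
  simp only [LinearMap.comp_add]
  abel

end GradientPaths

/-! ### Sequences of reductions -/

section Reductions

variable {R : Type u} [Ring R] {X : Type v} [PartialOrder X]

/-- A list of pairs, the latest first, that are matched one after the other: each pair is a
covering pair of unmatched elements with invertible block, and its lower element lies below none
of the upper elements matched before. -/
def IsReductionSeq (G : BlockData.{u, v, w} R X) : List (X × X) → Prop
  | [] => True
  | q :: L => IsReductionSeq G L ∧ q.1 ⋖ q.2 ∧ Function.Bijective (G.map q.1 q.2) ∧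
      IsCritical {r | r ∈ L} q.1 ∧ IsCritical {r | r ∈ L} q.2 ∧ ∀ r ∈ L, ¬ q.1 ⋖ r.2

theorem setOf_mem_cons {α : Type*} (q : α) (L : List α) :
    {r | r ∈ q :: L} = insert q {r | r ∈ L} := by
  ext r; simp

theorem isCritical_insert {X : Type v} {S : Set (X × X)} {q : X × X} {m : X} :
    IsCritical (insert q S) m ↔ IsCritical S m ∧ m ≠ q.1 ∧ m ≠ q.2 := by
  obtain ⟨x, y⟩ := q
  simp only [IsCritical, Set.mem_insert_iff, Prod.mk.injEq, not_or]
  constructor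
  · refine fun h => ⟨fun z => ⟨(h z).1.2, (h z).2.2⟩, ?_, ?_⟩
    · rintro rfl; exact (h y).1.1 ⟨rfl, rfl⟩
    · rintro rfl; exact (h x).2.1 ⟨rfl, rfl⟩
  · rintro ⟨h, h1, h2⟩ z
    exact ⟨⟨fun e => h1 e.1, (h z).1⟩, ⟨fun e => h2 e.2, (h z).2⟩⟩

theorem IsCritical.ne_fst {X : Type v} {S : Set (X × X)} {m : X} (h : IsCritical S m) {q : X × X}
    (hq : q ∈ S) : m ≠ q.1 := by
  rintro rfl; exact (h q.2).1 hq

theorem IsCritical.ne_snd {X : Type v} {S : Set (X × X)} {m : X} (h : IsCritical S m) {q : X × X}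
    (hq : q ∈ S) : m ≠ q.2 := by
  rintro rfl; exact (h q.1).2 hq

theorem IsCritical.notMem {X : Type v} {S : Set (X × X)} {q : X × X} (h : IsCritical S q.1) :
    q ∉ S := (h q.2).1

theorem morseMap_eq_zero {G : BlockData.{u, v, w} R X} (hG : ∀ x y, ¬ x ⋖ y → G.map x y = 0)
    {S : Set (X × X)} {m m' : X} (hm : ¬ MorseCovers S m m') : morseMap G S m m' = 0 := by
  have : flowSet S m m' = ∅ :=
    Set.eq_empty_of_forall_notMem fun γ h => hm (Or.inr ⟨γ.1, γ.2, h⟩)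
  rw [morseMap_eq, this, finsum_mem_empty, add_zero, hG _ _ fun h => hm (Or.inl h)]

namespace IsReductionSeq

variable {G : BlockData.{u, v, w} R X} {L : List (X × X)}

theorem isPartialMatching (h : IsReductionSeq G L) : IsPartialMatching {r | r ∈ L} := by
  induction L with
  | nil => exact ⟨fun p hp => by simp at hp, fun p hp => by simp at hp⟩
  | cons q L ih =>
    obtain ⟨h1, h2, -, h3, h4, -⟩ := h
    obtain ⟨hd, hp⟩ := ih h1
    rw [setOf_mem_cons]
    refine ⟨?_, ?_⟩
    · rintro p (rfl | hp)
      · exact h2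
      · exact hd p hp
    · rintro p (rfl | hpL) r (rfl | hrL) hne
      · exact absurd rfl hne
      · exact ⟨h3.ne_fst hrL, h3.ne_snd hrL, h4.ne_fst hrL, h4.ne_snd hrL⟩
      · exact ⟨(h3.ne_fst hpL).symm, (h4.ne_fst hpL).symm, (h3.ne_snd hpL).symm,
          (h4.ne_snd hpL).symm⟩
      · exact hp p hpL r hrL hne

theorem transGen_lhd_of_insert {S : Set (X × X)} {q : X × X}
    (hfree : ∀ r ∈ S, ¬ q.1 ⋖ r.2) {a b : X × X}
    (h : Relation.TransGen (Lhd (insert q S)) a b) (hb : b ≠ q) :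
    Relation.TransGen (Lhd S) a b := by
  have key : ∀ {a b : X × X}, Lhd (insert q S) a b → b ≠ q → a ≠ q ∧ Lhd S a b := by
    rintro a b ⟨ha, hb, hab⟩ hne
    have hbS : b ∈ S := hb.resolve_left hne
    have haq : a ≠ q := by
      rintro rfl; exact hfree b hbS hab
    exact ⟨haq, ha.resolve_left haq, hbS, hab⟩
  induction h with
  | single h => exact .single (key h hb).2
  | tail _ h ih => exact .tail (ih (key h hb).1) (key h hb).2

theorem isAcyclicMatching (h : IsReductionSeq G L) : IsAcyclicMatching {r | r ∈ L} := by
  refine ⟨h.isPartialMatching, ?_⟩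
  have mem_left : ∀ {S : Set (X × X)} {a b : X × X}, Relation.TransGen (Lhd S) a b → a ∈ S := by
    intro S a b h
    induction h with
    | single h => exact h.1
    | tail _ _ ih => exact ih
  induction L with
  | nil => exact fun p q h => by simpa using mem_left h
  | cons q L ih =>
    obtain ⟨h1, -, -, h3, -, h5⟩ := h
    rw [setOf_mem_cons]
    intro p r hpr hrp
    by_cases hp : p = q <;> by_cases hr : r = q
    · rw [hp, hr]
    · subst hp
      exact absurd (mem_left (transGen_lhd_of_insert h5 hpr hr)) h3.notMem
    · subst hr
      exact absurd (mem_left (transGen_lhd_of_insert h5 hrp hp)) h3.notMem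
    · exact ih h1 p r (transGen_lhd_of_insert h5 hpr hr) (transGen_lhd_of_insert h5 hrp hp)

theorem isCompatible (h : IsReductionSeq G L) : IsCompatible G {r | r ∈ L} := by
  induction L with
  | nil => intro p hp; simp at hp
  | cons q L ih =>
    intro p hp
    rcases List.mem_cons.1 hp with rfl | hp
    · exact h.2.2.1
    · exact ih h.1 p hp

theorem flowSet_finite (h : IsReductionSeq G L) (m m' : X) :
    (flowSet {r | r ∈ L} m m').Finite := by
  induction L generalizing m m' with
  | nil =>
    have : flowSet {r : X × X | r ∈ ([] : List (X × X))} m m' = ∅ :=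
      Set.eq_empty_of_forall_notMem fun γ h => by simpa using h.1.head_mem
    rw [this]; exact Set.finite_empty
  | cons q L ih =>
    obtain ⟨h1, -, -, h3, -, h5⟩ := h
    rw [setOf_mem_cons]
    exact flowSet_insert_finite h3.notMem h5 (ih h1) m m'

theorem nodup_map_fst (h : IsReductionSeq G L) : (L.map Prod.fst).Nodup := by
  induction L with
  | nil => simp
  | cons q L ih =>
    obtain ⟨h1, -, -, h3, -, -⟩ := h
    refine List.nodup_cons.2 ⟨fun hm => ?_, ih h1⟩
    obtain ⟨r, hr, e⟩ := List.mem_map.1 hm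
    exact h3.ne_fst hr e.symm

theorem dim_of_morseCovers {dim : X → ℕ} (hdim : ∀ x y, x ⋖ y → dim y = dim x + 1)
    (h : IsReductionSeq G L) {m m' : X} (hm : MorseCovers {r | r ∈ L} m m') :
    dim m' = dim m + 1 := by
  induction L generalizing m m' with
  | nil => exact hdim _ _ ((morseCovers_of_free (by simp)).1 hm)
  | cons q L ih =>
    obtain ⟨h1, h2, -, h3, -, h5⟩ := h
    rw [setOf_mem_cons, morseCovers_insert h3.notMem h5] at hm
    rcases hm with hm | ⟨ha, hb⟩
    · exact ih h1 hm
    · rw [hdim _ _ ha, ← ih h1 hb, hdim _ _ h2]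

theorem morseMap_cons (hG : ∀ x y, ¬ x ⋖ y → G.map x y = 0) {q : X × X}
    (h : IsReductionSeq G (q :: L)) (m m' : X) :
    morseMap G {r | r ∈ q :: L} m m' = morseMap G {r | r ∈ L} m m' -
      morseMap G {r | r ∈ L} q.1 m' ∘ₗ linInv (morseMap G {r | r ∈ L} q.1 q.2) ∘ₗ
        morseMap G {r | r ∈ L} m q.2 := by
  obtain ⟨h1, -, -, h3, -, h5⟩ := h
  rw [setOf_mem_cons, morseMap_insert G hG h3.notMem h5 h1.flowSet_finite,
    morseMap_of_free (S := {r | r ∈ L}) G h5, morseMap_of_free (S := {r | r ∈ L}) G h5]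

theorem morseCovers_cons {q : X × X} (h : IsReductionSeq G (q :: L)) {m m' : X} :
    MorseCovers {r | r ∈ q :: L} m m' ↔ MorseCovers {r | r ∈ L} m m' ∨
      (MorseCovers {r | r ∈ L} q.1 m' ∧ MorseCovers {r | r ∈ L} m q.2) := by
  obtain ⟨-, -, -, h3, -, h5⟩ := h
  rw [setOf_mem_cons, morseCovers_insert h3.notMem h5, 
    morseCovers_of_free (S := {r | r ∈ L}) h5]

end IsReductionSeq

theorem linInv_comp {M N : Type w} [AddCommGroup M] [Module R M] [AddCommGroup N] [Module R N]
    {f : M →ₗ[R] N} (hf : Function.Bijective f) : linInv f ∘ₗ f = LinearMap.id := by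
  ext a
  simp only [linInv, dif_pos hf, LinearMap.comp_apply, LinearMap.id_apply]
  exact (LinearEquiv.ofBijective f hf).symm_apply_apply a

theorem comp_linInv {M N : Type w} [AddCommGroup M] [Module R M] [AddCommGroup N] [Module R N]
    {f : M →ₗ[R] N} (hf : Function.Bijective f) : f ∘ₗ linInv f = LinearMap.id := by
  ext a
  simp only [linInv, dif_pos hf, LinearMap.comp_apply, LinearMap.id_apply]
  exact (LinearEquiv.ofBijective f hf).apply_symm_apply a

/-! ### Cochain complexes in terms of blocks -/

theorem BlockData.coboundary_apply {Y : Type v} [Fintype Y] (G : BlockData.{u, v, w} R Y)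
    (dim : Y → ℕ) (n : ℕ) (f : G.Cochain dim n) (y : {y : Y // dim y = n + 1}) :
    G.coboundary dim n f y = ∑ x : {x : Y // dim x = n}, G.map x.1 y.1 (f x) := by
  rw [BlockData.coboundary, LinearMap.pi_apply, LinearMap.sum_apply]
  exact Finset.sum_congr (by ext; simp) fun _ _ => rfl

theorem BlockData.isCochainComplex_iff {Y : Type v} [Fintype Y] (G : BlockData.{u, v, w} R Y)
    (dim : Y → ℕ) (hG : ∀ x y, dim y ≠ dim x + 1 → G.map x y = 0) :
    G.IsCochainComplex dim ↔ ∀ w v, ∑ z, G.map z v ∘ₗ G.map w z = 0 := by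
  classical
  have restrict : ∀ (n : ℕ) (w v : Y) (a : G.obj w), dim w = n →
      ∑ z : {z : Y // dim z = n + 1}, G.map z.1 v (G.map w z.1 a) =
        (∑ z, G.map z v ∘ₗ G.map w z) a := by
    rintro n w v a rfl
    rw [LinearMap.sum_apply]
    simp only [LinearMap.comp_apply]
    rw [← Finset.sum_subtype (Finset.univ.filter fun z => dim z = dim w + 1) (by simp)
      (fun z => G.map z v (G.map w z a))]
    refine Finset.sum_subset (Finset.subset_univ _) fun z _ hz => ?_
    rw [hG w z (by simpa using hz), LinearMap.zero_apply, map_zero]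
  constructor
  · intro h w v
    by_cases hv : dim v = dim w + 1 + 1
    · ext a
      have := congrFun (LinearMap.congr_fun (h (dim w))
        (Pi.single (⟨w, rfl⟩ : {x : Y // dim x = dim w}) a)) ⟨v, hv⟩
      rw [LinearMap.comp_apply, BlockData.coboundary_apply] at this
      simp only [BlockData.coboundary_apply] at this
      rw [← restrict _ w v a rfl, LinearMap.zero_apply]
      refine Eq.trans (Finset.sum_congr rfl fun z _ => congrArg _ ?_) this
      rw [Finset.sum_eq_single (⟨w, rfl⟩ : {x : Y // dim x = dim w})]
      · rw [Pi.single_eq_same]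
      · intro b _ hb
        rw [Pi.single_eq_of_ne hb, map_zero]
      · simp
    · refine Finset.sum_eq_zero fun z _ => ?_
      by_cases hz : dim z = dim w + 1
      · rw [hG z v (by rw [hz]; exact hv), LinearMap.zero_comp]
      · rw [hG w z hz, LinearMap.comp_zero]
  · intro h n
    refine LinearMap.ext fun f => funext fun v => ?_
    rw [LinearMap.comp_apply, BlockData.coboundary_apply]
    simp only [BlockData.coboundary_apply, map_sum]
    rw [Finset.sum_comm]
    refine Finset.sum_eq_zero fun x _ => ?_
    rw [restrict n x.1 v.1 (f x) x.2, h, LinearMap.zero_apply]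

open Classical in
/-- The Morse data of a reduction sequence square to zero. -/
theorem IsReductionSeq.sum_morseMap_comp [Fintype X] {G : BlockData.{u, v, w} R X}
    (hG : ∀ x y, ¬ x ⋖ y → G.map x y = 0) (hsq : ∀ w v, ∑ z, G.map z v ∘ₗ G.map w z = 0)
    {L : List (X × X)} (h : IsReductionSeq G L) (w v : X)
    (hw : IsCritical {r | r ∈ L} w) (hv : IsCritical {r | r ∈ L} v) :
    ∑ z with IsCritical {r | r ∈ L} z,
      morseMap G {r | r ∈ L} z v ∘ₗ morseMap G {r | r ∈ L} w z = 0 := by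
  induction L generalizing w v with
  | nil =>
    have hmap : ∀ m m', morseMap G {r | r ∈ ([] : List (X × X))} m m' = G.map m m' :=
      fun m m' => morseMap_of_free G (by simp) m'
    simp only [hmap]
    rw [Finset.filter_true_of_mem (by simp [IsCritical])]
    exact hsq w v
  | cons q L ih =>
    have hL := h.1
    have hq1 := h.2.2.2.1
    have hq2 := h.2.2.2.2.1
    have hbij : Function.Bijective (morseMap G {r | r ∈ L} q.1 q.2) := by
      rw [morseMap_of_free (S := {r | r ∈ L}) G h.2.2.2.2.2]; exact h.2.2.1
    have hw' := hw
    have hv' := hv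
    rw [setOf_mem_cons, isCritical_insert] at hw' hv'
    specialize ih hL
    have hs : ∑ z with IsCritical {r | r ∈ q :: L} z,
        morseMap G {r | r ∈ q :: L} z v ∘ₗ morseMap G {r | r ∈ q :: L} w z =
        ∑ z with IsCritical {r | r ∈ L} z,
          morseMap G {r | r ∈ q :: L} z v ∘ₗ morseMap G {r | r ∈ q :: L} w z := by
      refine Finset.sum_subset (fun z hz => ?_) (fun z hz hz' => ?_)
      · simp only [Finset.mem_filter, Finset.mem_univ, true_and] at hz ⊢
        rw [setOf_mem_cons, isCritical_insert] at hz
        exact hz.1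
      · simp only [Finset.mem_filter, Finset.mem_univ, true_and] at hz hz'
        rw [setOf_mem_cons, isCritical_insert] at hz'
        have : z = q.1 ∨ z = q.2 := by tauto
        rcases this with rfl | rfl
        · rw [h.morseMap_cons hG q.1 v, linInv_comp hbij]
          simp
        · rw [h.morseMap_cons hG w q.2, ← LinearMap.comp_assoc, comp_linInv hbij]
          simp
    rw [hs]
    set a := morseMap G {r | r ∈ L} with ha
    set i := linInv (a q.1 q.2) with hi
    have expand : ∀ z, morseMap G {r | r ∈ q :: L} z v ∘ₗ morseMap G {r | r ∈ q :: L} w z =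
        a z v ∘ₗ a w z - (a z v ∘ₗ a q.1 z) ∘ₗ (i ∘ₗ a w q.2)
          - (a q.1 v ∘ₗ i) ∘ₗ (a z q.2 ∘ₗ a w z)
          + (a q.1 v ∘ₗ i) ∘ₗ (a z q.2 ∘ₗ a q.1 z) ∘ₗ (i ∘ₗ a w q.2) := by
      intro z
      rw [h.morseMap_cons hG z v, h.morseMap_cons hG w z]
      ext b
      simp only [LinearMap.comp_apply, LinearMap.sub_apply, LinearMap.add_apply, map_sub]
      simp only [ha, hi]
      abel
    have hr : ∀ {M N P : Type w} [AddCommGroup M] [AddCommGroup N] [AddCommGroup P] [Module R M]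
        [Module R N] [Module R P] (s : Finset X) (f : X → N →ₗ[R] P) (g : M →ₗ[R] N),
        ∑ z ∈ s, f z ∘ₗ g = (∑ z ∈ s, f z) ∘ₗ g := by
      intros; ext; simp
    have hl : ∀ {M N P : Type w} [AddCommGroup M] [AddCommGroup N] [AddCommGroup P] [Module R M]
        [Module R N] [Module R P] (s : Finset X) (f : X → M →ₗ[R] N) (g : N →ₗ[R] P),
        ∑ z ∈ s, g ∘ₗ f z = g ∘ₗ (∑ z ∈ s, f z) := by
      intros; ext; simp
    simp only [expand, Finset.sum_add_distrib, Finset.sum_sub_distrib]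
    rw [hl, hr, hl, hr, ih w v hw'.1 hv'.1, ih q.1 v hq1 hv'.1, ih w q.2 hw'.1 hq2,
      ih q.1 q.2 hq1 hq2]
    simp

theorem IsReductionSeq.isCochainComplex [Fintype X] {G : BlockData.{u, v, w} R X} {dim : X → ℕ}
    (hdim : ∀ x y, x ⋖ y → dim y = dim x + 1)
    (hG : ∀ x y, ¬ x ⋖ y → G.map x y = 0) (hc : G.IsCochainComplex dim)
    {L : List (X × X)} (h : IsReductionSeq G L) :
    (morseData G {r | r ∈ L}).IsCochainComplex (fun m => dim m.1) := by
  classical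
  have hsq := (G.isCochainComplex_iff dim fun x y hxy => hG x y fun hc => hxy (hdim x y hc)).1 hc
  refine (BlockData.isCochainComplex_iff _ _ fun m m' hm => ?_).2 fun m m' => ?_
  · exact morseMap_eq_zero hG fun hc => hm (h.dim_of_morseCovers hdim hc)
  · have := h.sum_morseMap_comp hG hsq m.1 m'.1 m.2 m'.2
    rw [Finset.sum_subtype (Finset.univ.filter (IsCritical {r | r ∈ L}))
      (p := IsCritical {r | r ∈ L}) (by simp)
      (fun z => morseMap G {r | r ∈ L} z m'.1 ∘ₗ morseMap G {r | r ∈ L} m.1 z)] at this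
    exact this

theorem isPartialOrder_morseLE {S : Set (X × X)} {dim : X → ℕ}
    (hdim : ∀ m m', MorseCovers S m m' → dim m' = dim m + 1) :
    IsPartialOrder {m : X // IsCritical S m} (MorseLE S) := by
  have hlt : ∀ a b : {m : X // IsCritical S m}, MorseLE S a b → a = b ∨ dim a.1 < dim b.1 := by
    intro a b h
    induction h with
    | refl => exact Or.inl rfl
    | tail _ h ih =>
      have := hdim _ _ h
      rcases ih with rfl | ih
      · right; omega
      · right; omega
  exact
    { refl := fun a => Relation.ReflTransGen.refl
      trans := fun a b c => Relation.ReflTransGen.trans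
      antisymm := fun a b h1 h2 => by
        rcases hlt a b h1 with h | h
        · exact h
        · rcases hlt b a h2 with h' | h'
          · exact h'.symm
          · omega }

end Reductions

/-! ### Matrix arithmetic -/

section Matrices

variable {R : Type u}

theorem entries_eq_ofFn {a b : ℕ} (A : Matrix (Fin a) (Fin b) R) :
    entries A = List.ofFn fun k : Fin (a * b) => A k.divNat k.modNat := by
  rw [entries, List.ofFn_mul]
  congr 2
  funext i
  congr 1
  funext j
  have hb : 0 < b := j.pos
  congr 1 <;> ext
  · simp [Fin.divNat, Nat.add_div_of_dvd_right, Nat.mul_div_cancel _ hb,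
      Nat.div_eq_of_lt j.2]
  · simp [Fin.modNat, Nat.mod_eq_of_lt j.2]

theorem length_entries {a b : ℕ} (A : Matrix (Fin a) (Fin b) R) :
    (entries A).length = a * b := by
  rw [entries_eq_ofFn, List.length_ofFn]

theorem getD_entries [Zero R] {a b : ℕ} (A : Matrix (Fin a) (Fin b) R) (i : Fin a) (j : Fin b) :
    (entries A).getD (i * b + j) 0 = A i j := by
  have hb : 0 < b := j.pos
  have hlt : (i : ℕ) * b + j < a * b :=
    calc (i : ℕ) * b + j < i * b + b := by omega
      _ = (i + 1) * b := by ring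
      _ ≤ a * b := Nat.mul_le_mul_right _ i.2
  rw [List.getD_eq_getElem _ _ (by rwa [length_entries])]
  simp only [entries_eq_ofFn, List.getElem_ofFn]
  congr 1 <;> ext
  · simp [Fin.divNat, Nat.add_div_of_dvd_right, Nat.mul_div_cancel _ hb,
      Nat.div_eq_of_lt j.2]
  · simp [Fin.modNat, Nat.mod_eq_of_lt j.2]

theorem ofEntries_entries [Zero R] {a b : ℕ} (A : Matrix (Fin a) (Fin b) R) :
    ofEntries a b b (entries A) = A := by
  ext i j
  exact getD_entries A i j

theorem pad_apply [Zero R] {a b e : ℕ} (A : Matrix (Fin a) (Fin b) R) (ha : a ≤ e) (hb : b ≤ e)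
    (i : Fin a) (j : Fin b) : pad e A (Fin.castLE ha i) (Fin.castLE hb j) = A i j := by
  simp [pad]

theorem pad_mul_apply [Ring R] {a b c e : ℕ} (A : Matrix (Fin a) (Fin b) R)
    (B : Matrix (Fin b) (Fin c) R) (ha : a ≤ e) (hb : b ≤ e) (hc : c ≤ e)
    (i : Fin a) (j : Fin c) :
    (pad e A * pad e B) (Fin.castLE ha i) (Fin.castLE hc j) = (A * B) i j := by
  rw [Matrix.mul_apply, Matrix.mul_apply]
  have himg : ∑ k : Fin b, A i k * B k j = ∑ k ∈ Finset.univ.map (Fin.castLEEmb hb),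
      pad e A (Fin.castLE ha i) k * pad e B k (Fin.castLE hc j) := by
    rw [Finset.sum_map]
    refine Finset.sum_congr rfl fun k _ => ?_
    rw [Fin.castLEEmb_apply, pad_apply, pad_apply]
  rw [himg]
  symm
  refine Finset.sum_subset (Finset.subset_univ _) fun k _ hk => ?_
  have : ¬ (k : ℕ) < b := fun hlt => hk (Finset.mem_map.2 ⟨⟨k, hlt⟩, Finset.mem_univ _, rfl⟩)
  simp [pad, this]

variable [Ring R] (kit : MatrixKit R)

theorem MatrixKit.mulRect_eq {a b c : ℕ} (A : Matrix (Fin a) (Fin b) R)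
    (B : Matrix (Fin b) (Fin c) R) : kit.mulRect A B = A * B := by
  have ha : a ≤ mulSize a b c := le_max_left _ _
  have hb : b ≤ mulSize a b c := (le_max_left _ _).trans (le_max_right _ _)
  have hc : c ≤ mulSize a b c := (le_max_right _ _).trans (le_max_right _ _)
  ext i j
  rw [← pad_mul_apply A B ha hb hc, MatrixKit.mulRect]
  simp only [kit.mul_run, Option.getD_some]
  exact getD_entries _ (Fin.castLE ha i) (Fin.castLE hc j)

theorem MatrixKit.invRect_eq_some {a b : ℕ} {A : Matrix (Fin a) (Fin b) R}
    {B : Matrix (Fin b) (Fin a) R} (h : kit.invRect A = some B) : A * B = 1 ∧ B * A = 1 := by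
  by_cases hA : ∃ B : Matrix (Fin b) (Fin a) R, A * B = 1 ∧ B * A = 1
  · obtain ⟨B', h1, h2⟩ := hA
    rw [MatrixKit.invRect, kit.inv_run_some a b A B' h1 h2, Option.map_some,
      ofEntries_entries] at h
    rw [← Option.some.inj h]
    exact ⟨h1, h2⟩
  · rw [MatrixKit.invRect, kit.inv_run_none a b A hA] at h
    simp at h

/-! ### Bounds for the matrix programs -/

theorem Prog.length_lt_cost {s : ℕ} {P : Prog R s} {m : Fin s → R} {out : List R}
    (h : P.eval m = some out) : out.length + 1 ≤ P.cost := by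
  induction P generalizing m with
  | ret o =>
    simp only [Prog.eval, Option.some.injEq] at h
    simp [Prog.cost, ← h]
  | fail => simp [Prog.eval] at h
  | const dst a k ih => exact (ih h).trans (Nat.le_succ _)
  | add dst i j k ih => exact (ih h).trans (Nat.le_succ _)
  | sub dst i j k ih => exact (ih h).trans (Nat.le_succ _)
  | mul dst i j k ih => exact (ih h).trans (Nat.le_succ _)
  | inv dst i k k' ih ih' =>
    simp only [Prog.eval] at h
    simp only [Prog.cost]
    split_ifs at h
    · have := ih h; omega
    · have := ih' h; omega
  | ifZero i k k' ih ih' =>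
    simp only [Prog.eval] at h
    simp only [Prog.cost]
    split_ifs at h
    · have := ih h; omega
    · have := ih' h; omega

theorem MatrixKit.sq_lt_cost_mul (e : ℕ) : e ^ 2 + 1 ≤ (kit.mul e).cost := by
  have := Prog.length_lt_cost (kit.mul_run e 0 0)
  rwa [length_entries, ← sq] at this

/-- A bound for the time of one operation on matrices of size at most `d`. -/
def MatrixKit.opTime (d : ℕ) : ℕ :=
  (Finset.range (d + 1)).sup (fun e => (kit.mul e).cost) +
  (Finset.range (d + 1)).sup (fun a => (Finset.range (d + 1)).sup fun b => (kit.inv a b).cost) +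
  3 * (d + 1) ^ 2

/-- A bound for the registers used by one operation on matrices of size at most `d`. -/
def MatrixKit.opRegs (d : ℕ) : ℕ :=
  max ((Finset.range (d + 1)).sup kit.mulRegs)
    ((Finset.range (d + 1)).sup fun a => (Finset.range (d + 1)).sup (kit.invRegs a))

theorem MatrixKit.mulSize_le {a b c d : ℕ} (ha : a ≤ d) (hb : b ≤ d) (hc : c ≤ d) :
    MatrixKit.mulSize a b c ≤ d := max_le ha (max_le hb hc)

theorem mul_le_succ_sq {a b d : ℕ} (ha : a ≤ d) (hb : b ≤ d) : a * b ≤ (d + 1) ^ 2 := by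
  rw [sq]; exact Nat.mul_le_mul (by omega) (by omega)

theorem MatrixKit.mulTime_le {a b c d : ℕ} (ha : a ≤ d) (hb : b ≤ d) (hc : c ≤ d) :
    kit.mulTime a b c ≤ kit.opTime d := by
  have he := MatrixKit.mulSize_le ha hb hc
  have h1 : mulSize a b c ^ 2 ≤ (d + 1) ^ 2 := by
    rw [sq (mulSize a b c)]; exact mul_le_succ_sq he he
  have h2 : (kit.mul (mulSize a b c)).cost ≤ _ := Finset.le_sup
    (f := fun e => (kit.mul e).cost) (Finset.mem_range.2 (Nat.lt_add_one_of_le he))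
  have h3 : a * c ≤ (d + 1) ^ 2 := mul_le_succ_sq ha hc
  rw [MatrixKit.mulTime, MatrixKit.opTime]
  omega

theorem MatrixKit.invTime_le {a b d : ℕ} (ha : a ≤ d) (hb : b ≤ d) :
    kit.invTime a b ≤ kit.opTime d := by
  have h1 : a * b ≤ (d + 1) ^ 2 := mul_le_succ_sq ha hb
  have h2 : (kit.inv a b).cost ≤ _ := (Finset.le_sup (f := fun b => (kit.inv a b).cost)
    (Finset.mem_range.2 (Nat.lt_add_one_of_le hb))).trans
    (Finset.le_sup (f := fun a => (Finset.range (d + 1)).sup fun b => (kit.inv a b).cost)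
      (Finset.mem_range.2 (Nat.lt_add_one_of_le ha)))
  have h3 : b * a ≤ (d + 1) ^ 2 := mul_le_succ_sq hb ha
  rw [MatrixKit.invTime, MatrixKit.opTime]
  omega

theorem MatrixKit.mul_add_two_le_opTime {a b d : ℕ} (ha : a ≤ d) (hb : b ≤ d) :
    a * b + 2 ≤ kit.opTime d := by
  have h1 : a * b ≤ (d + 1) ^ 2 := mul_le_succ_sq ha hb
  have h2 : 1 ≤ (d + 1) ^ 2 := Nat.one_le_pow _ _ (Nat.succ_pos _)
  rw [MatrixKit.opTime]
  omega

theorem MatrixKit.mulRegs_le {e d : ℕ} (he : e ≤ d) : kit.mulRegs e ≤ kit.opRegs d :=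
  (Finset.le_sup (f := kit.mulRegs) (Finset.mem_range.2 (Nat.lt_add_one_of_le he))).trans
    (le_max_left _ _)

theorem MatrixKit.invRegs_le {a b d : ℕ} (ha : a ≤ d) (hb : b ≤ d) :
    kit.invRegs a b ≤ kit.opRegs d :=
  ((Finset.le_sup (f := kit.invRegs a) (Finset.mem_range.2 (Nat.lt_add_one_of_le hb))).trans
    (Finset.le_sup (f := fun a => (Finset.range (d + 1)).sup (kit.invRegs a))
      (Finset.mem_range.2 (Nat.lt_add_one_of_le ha)))).trans (le_max_right _ _)

theorem MatrixKit.HasExponent.nonneg {kit : MatrixKit R} {ω : ℝ} (h : kit.HasExponent ω) :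
    0 ≤ ω := by
  by_contra! hω
  obtain ⟨K, hK⟩ := h
  obtain ⟨e, he⟩ := exists_nat_gt (max K 1)
  have he1 : (1 : ℝ) < e := (le_max_right _ _).trans_lt he
  have h1 := (hK e (by exact_mod_cast he1.le)).1
  have h2 : ((e ^ 2 + 1 : ℕ) : ℝ) ≤ (kit.mul e).cost := by exact_mod_cast kit.sq_lt_cost_mul e
  have h3 : (e : ℝ) ^ ω ≤ 1 := Real.rpow_le_one_of_one_le_of_nonpos he1.le hω.le
  have h4 : (0 : ℝ) ≤ (e : ℝ) ^ ω := by positivity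
  have h5 : K < e := (le_max_left _ _).trans_lt he
  push_cast at h2
  nlinarith

theorem MatrixKit.HasExponent.exists_opTime_le {kit : MatrixKit R} {ω : ℝ}
    (h : kit.HasExponent ω) :
    ∃ C : ℝ, 0 ≤ C ∧ ∀ d : ℕ, 1 ≤ d → (kit.opTime d : ℝ) ≤ C * (d : ℝ) ^ ω := by
  have hω := h.nonneg
  obtain ⟨K, hK⟩ := h
  have hK0 : 0 ≤ K := by
    have h1 := (hK 1 le_rfl).1
    have h2 : (0 : ℝ) ≤ (kit.mul 1).cost := Nat.cast_nonneg _
    simp only [Nat.cast_one, Real.one_rpow, mul_one] at h1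
    linarith
  refine ⟨(kit.mul 0).cost + K + K + 12 * K, by positivity, fun d hd => ?_⟩
  have hd1 : (1 : ℝ) ≤ d := by exact_mod_cast hd
  have hdω : (1 : ℝ) ≤ (d : ℝ) ^ ω := Real.one_le_rpow hd1 hω
  have hmul : (((Finset.range (d + 1)).sup fun e => (kit.mul e).cost : ℕ) : ℝ) ≤
      ((kit.mul 0).cost + K) * (d : ℝ) ^ ω := by
    obtain ⟨e, he, heq⟩ := Finset.exists_mem_eq_sup (Finset.range (d + 1)) (by simp)
      (fun e => (kit.mul e).cost)
    rw [heq]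
    have hc : (0 : ℝ) ≤ (kit.mul 0).cost := Nat.cast_nonneg _
    rcases Nat.eq_zero_or_pos e with rfl | hpos
    · nlinarith
    · have h1 := (hK e hpos).1
      have h2 : (e : ℝ) ^ ω ≤ (d : ℝ) ^ ω := Real.rpow_le_rpow (Nat.cast_nonneg _)
        (by exact_mod_cast Nat.lt_succ_iff.1 (Finset.mem_range.1 he)) hω
      nlinarith
  have hinv : (((Finset.range (d + 1)).sup fun a =>
      (Finset.range (d + 1)).sup fun b => (kit.inv a b).cost : ℕ) : ℝ) ≤ K * (d : ℝ) ^ ω := by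
    obtain ⟨a, ha, heq⟩ := Finset.exists_mem_eq_sup (Finset.range (d + 1)) (by simp)
      (fun a => (Finset.range (d + 1)).sup fun b => (kit.inv a b).cost)
    obtain ⟨b, hb, heq'⟩ := Finset.exists_mem_eq_sup (Finset.range (d + 1)) (by simp)
      (fun b => (kit.inv a b).cost)
    rw [heq, heq']
    exact (hK d hd).2 a b (Nat.lt_succ_iff.1 (Finset.mem_range.1 ha))
      (Nat.lt_succ_iff.1 (Finset.mem_range.1 hb))
  have hsq : (3 * ((d : ℝ) + 1) ^ 2) ≤ 12 * K * (d : ℝ) ^ ω := by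
    have h1 := (hK d hd).1
    have h2 : ((d ^ 2 + 1 : ℕ) : ℝ) ≤ (kit.mul d).cost := by
      exact_mod_cast kit.sq_lt_cost_mul d
    push_cast at h2
    nlinarith
  rw [MatrixKit.opTime]
  push_cast at hmul hinv ⊢
  linarith

theorem MatrixKit.HasWorkspace.opRegs_le {kit : MatrixKit R} {W : ℕ} (h : kit.HasWorkspace W)
    {d : ℕ} (hd : 1 ≤ d) : kit.opRegs d ≤ kit.mulRegs 0 + W * d ^ 2 := by
  refine max_le (Finset.sup_le fun e he => ?_) (Finset.sup_le fun a ha => Finset.sup_le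
    fun b hb => ?_)
  · rcases Nat.eq_zero_or_pos e with rfl | hpos
    · omega
    · have h1 := (h e hpos).1
      have h2 : W * e ^ 2 ≤ W * d ^ 2 := Nat.mul_le_mul_left _
        (Nat.pow_le_pow_left (Nat.lt_succ_iff.1 (Finset.mem_range.1 he)) _)
      omega
  · have := (h d hd).2 a b (Nat.lt_succ_iff.1 (Finset.mem_range.1 ha))
      (Nat.lt_succ_iff.1 (Finset.mem_range.1 hb))
    omega

end Matrices

/-! ### Matrices of linear maps -/

namespace Input

variable {R : Type u} [Ring R] {X : Type v} [PartialOrder X] [Fintype X]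
  (I : Input.{u, v, w} R X)

theorem matrixOf_comp {x y z : X} (g : I.F.obj y →ₗ[R] I.F.obj z)
    (f : I.F.obj x →ₗ[R] I.F.obj y) :
    I.matrixOf (g ∘ₗ f) = I.matrixOf f * I.matrixOf g := by
  ext i j
  have h : f (I.basis x i) = ∑ k, I.matrixOf f i k • I.basis y k :=
    ((I.basis y).sum_repr (f (I.basis x i))).symm
  rw [Matrix.mul_apply]
  change (I.basis z).repr (g (f (I.basis x i))) j = _
  rw [h, map_sum, map_sum, Finsupp.finsetSum_apply]
  refine Finset.sum_congr rfl fun k _ => ?_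
  rw [map_smul, map_smul]
  rfl

theorem matrixOf_sub {x y : X} (f g : I.F.obj x →ₗ[R] I.F.obj y) :
    I.matrixOf (f - g) = I.matrixOf f - I.matrixOf g := by
  ext i j
  simp [matrixOf]

theorem matrixOf_zero {x y : X} :
    I.matrixOf (0 : I.F.obj x →ₗ[R] I.F.obj y) = 0 := by
  ext i j
  simp [matrixOf]

theorem matrixOf_id {x : X} : I.matrixOf (LinearMap.id : I.F.obj x →ₗ[R] I.F.obj x) = 1 := by
  ext i j
  simp [matrixOf, Finsupp.single_apply, Matrix.one_apply]

theorem matrixOf_injective {x y : X} :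
    Function.Injective (I.matrixOf : (I.F.obj x →ₗ[R] I.F.obj y) → _) := by
  intro f g h
  refine (I.basis x).ext fun i => (I.basis y).repr.injective (Finsupp.ext fun j => ?_)
  exact congrFun (congrFun h i) j

theorem matrixOf_surjective {x y : X} :
    Function.Surjective (I.matrixOf : (I.F.obj x →ₗ[R] I.F.obj y) → _) := by
  intro A
  refine ⟨(I.basis x).constr ℕ fun i => ∑ j, A i j • I.basis y j, ?_⟩
  ext i j
  simp [matrixOf, Finsupp.single_apply]

theorem bijective_and_matrixOf_linInv {x y : X} {f : I.F.obj x →ₗ[R] I.F.obj y}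
    {B : Matrix (Fin (I.rank y)) (Fin (I.rank x)) R}
    (h1 : I.matrixOf f * B = 1) (h2 : B * I.matrixOf f = 1) :
    Function.Bijective f ∧ I.matrixOf (linInv f) = B := by
  obtain ⟨g, rfl⟩ := I.matrixOf_surjective B
  have hgf : g ∘ₗ f = LinearMap.id := I.matrixOf_injective (by
    rw [matrixOf_comp, matrixOf_id, h1])
  have hfg : f ∘ₗ g = LinearMap.id := I.matrixOf_injective (by
    rw [matrixOf_comp, matrixOf_id, h2])
  have hbij : Function.Bijective f := Function.bijective_iff_has_inverse.2
    ⟨g, fun a => LinearMap.congr_fun hgf a, fun a => LinearMap.congr_fun hfg a⟩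
  refine ⟨hbij, congrArg _ ?_⟩
  calc linInv f = linInv f ∘ₗ (f ∘ₗ g) := by rw [hfg, LinearMap.comp_id]
    _ = g := by rw [← LinearMap.comp_assoc, linInv_comp hbij, LinearMap.id_comp]

theorem rank_le (x : X) : I.rank x ≤ I.maxRank := Finset.le_sup (Finset.mem_univ x)

theorem length_up_le (x : X) : (I.up x).length ≤ maxCovers X := by
  classical
  have : (I.up x).length = Set.ncard {y : X | x ⋖ y} := by
    rw [← List.toFinset_card_of_nodup (I.nodup_up x), ← Set.ncard_coe_finset]
    congr 1
    ext y
    simp [I.mem_up]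
  rw [this]
  exact Finset.le_sup (f := fun x : X => Set.ncard {y : X | x ⋖ y}) (Finset.mem_univ x)

theorem length_elems : I.elems.length = Fintype.card X := by
  classical
  rw [← List.toFinset_card_of_nodup I.nodup_elems, ← Finset.card_univ]
  congr 1
  ext x
  simp [I.mem_elems]

theorem sum_length_down_le :
    ∑ y, (I.down y).length ≤ Fintype.card X * maxCovers X := by
  classical
  have hswap : ∑ y, (I.down y).length = ∑ x, (I.up x).length := by
    have h1 : ∀ y, (I.down y).length = ∑ x, if x ⋖ y then 1 else 0 := fun y => by
      rw [← List.toFinset_card_of_nodup (I.nodup_down y), Finset.sum_boole, Nat.cast_id]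
      congr 1
      ext x
      simp [I.mem_down]
    have h2 : ∀ x, (I.up x).length = ∑ y, if x ⋖ y then 1 else 0 := fun x => by
      rw [← List.toFinset_card_of_nodup (I.nodup_up x), Finset.sum_boole, Nat.cast_id]
      congr 1
      ext y
      simp [I.mem_up]
    simp only [h1, h2]
    exact Finset.sum_comm
  rw [hswap]
  exact (Finset.sum_le_card_nsmul _ _ _ fun x _ => I.length_up_le x).trans (by simp)

end Input

/-! ### The elementary operations on the store -/

namespace Store

section Basic

variable {R : Type u} {X : Type v} {rank : X → ℕ} [Fintype X] [DecidableEq X]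

theorem decr_eq (l : List X) (s : Store R X rank) :
    decr l s = { s with
      cnt := fun z => s.cnt z - l.count z
      time := s.time + l.length
      mem := if l = [] then s.mem else max s.mem s.size } := by
  induction l generalizing s with
  | nil => simp [decr]
  | cons a l ih =>
    have h : decr (a :: l) s =
      decr l (({ s with cnt := Function.update s.cnt a (s.cnt a - 1) }).charge 1 0) := rfl
    rw [h, ih]
    simp only [charge]
    congr 1
    · funext z
      by_cases hz : z = a
      · subst hz; simp; omega
      · simp [hz, Ne.symm hz]
    · simp; omega
    · simp only [reduceCtorEq, if_false, add_zero]
      split_ifs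
      · rfl
      · change max (max s.mem s.size) s.size = _
        simp

theorem mark_eq (c : X) (s : Store R X rank) :
    mark c s = { s with
      crit := Function.update s.crit c true
      cnt := fun z => s.cnt z - (s.up c).count z
      time := s.time + 1 + (s.up c).length
      mem := max s.mem s.size } := by
  rw [mark, decr_eq]
  simp only [charge]
  congr 1
  split_ifs
  · rfl
  · change max (max s.mem s.size) s.size = _
    simp

theorem remove_eq (x : X) (s : Store R X rank) :
    remove x s = { s with
      alive := Function.update s.alive x false
      cnt := fun z => s.cnt z - (s.up x).count z
      time := s.time + 1 + (s.up x).length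
      mem := max s.mem s.size } := by
  rw [remove, decr_eq]
  simp only [charge]
  congr 1
  split_ifs
  · rfl
  · change max (max s.mem s.size) s.size = _
    simp

/-- The elements that are in the queue or may still enter it. -/
def Pending (s : Store R X rank) (z : X) : Prop := z ∈ s.queue ∨ s.queued z = false

/-- The queue lists present non-critical elements of dimension `k + 1` without repetition, all
of them flagged. -/
structure QueueOK (dim : X → ℕ) (k : ℕ) (s : Store R X rank) : Prop where
  nodup : s.queue.Nodup
  queued : ∀ z ∈ s.queue, s.queued z = true
  alive : ∀ z ∈ s.queue, s.alive z = true
  crit : ∀ z ∈ s.queue, s.crit z = false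
  dim : ∀ z ∈ s.queue, dim z = k + 1

theorem enqueue_spec (dim : X → ℕ) (k : ℕ) (l : List X) (s : Store R X rank)
    (h : s.QueueOK dim k) :
    ∃ q qd m, enqueue dim k l s =
        { s with queue := q, queued := qd, time := s.time + l.length, mem := m } ∧
      (enqueue dim k l s).QueueOK dim k ∧
      (∀ z, (enqueue dim k l s).Pending z ↔ s.Pending z) ∧
      ∀ b, s.mem ≤ b → (∀ q' : List X, q'.Nodup → ({ s with queue := q' }).size ≤ b) → m ≤ b := by
  induction l generalizing s with
  | nil => exact ⟨s.queue, s.queued, s.mem, rfl, h, fun _ => Iff.rfl, fun b h _ => h⟩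
  | cons a l ih =>
    by_cases hc : s.alive a && !s.crit a && !s.queued a && decide (dim a = k + 1)
    · have he : enqueue dim k (a :: l) s = enqueue dim k l
          (({ s with
              queue := s.queue ++ [a]
              queued := Function.update s.queued a true }).charge 1 0) := by
        rw [enqueue, List.foldl_cons, if_pos hc]; rfl
      simp only [Bool.and_eq_true, Bool.not_eq_true', decide_eq_true_eq] at hc
      obtain ⟨⟨⟨ha, hcr⟩, hqd⟩, hd⟩ := hc
      have hna : a ∉ s.queue := fun hm => by simp [h.queued a hm] at hqd
      have h' : QueueOK dim k (({ s with
          queue := s.queue ++ [a]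
          queued := Function.update s.queued a true }).charge 1 0) := by
        refine ⟨?_, ?_, ?_, ?_, ?_⟩ <;> simp only [charge]
        · exact List.nodup_append.2 ⟨h.nodup, by simp, by
            rintro b hb c hc rfl
            exact hna (by simpa [List.mem_singleton.1 hc] using hb)⟩
        all_goals
          intro z hz
          rcases List.mem_append.1 hz with hz | hz
        · have : z ≠ a := fun e => hna (e ▸ hz)
          simp [this, h.queued z hz]
        · simp [List.mem_singleton.1 hz]
        · exact h.alive z hz
        · rw [List.mem_singleton.1 hz]; exact ha
        · exact h.crit z hz
        · rw [List.mem_singleton.1 hz]; exact hcr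
        · exact h.dim z hz
        · rw [List.mem_singleton.1 hz]; exact hd
      obtain ⟨q, qd, m, h1, h2, h3, h4⟩ := ih _ h'
      refine ⟨q, qd, m, ?_, ?_, ?_, ?_⟩
      · rw [he, h1]; simp only [charge, List.length_cons]; congr 1; omega
      · rw [he]; exact h2
      · intro z
        rw [he, h3]
        simp only [Pending, charge, List.mem_append, List.mem_singleton]
        by_cases hz : z = a
        · subst hz; simp [hqd]
        · simp [hz]
      · intro b hb hq
        refine h4 b ?_ hq
        exact max_le hb (hq _ (h'.nodup))
    · have he : enqueue dim k (a :: l) s = enqueue dim k l (s.charge 1 0) := by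
        rw [enqueue, List.foldl_cons, if_neg hc]; rfl
      have h' : QueueOK dim k (s.charge 1 0) := ⟨h.1, h.2, h.3, h.4, h.5⟩
      obtain ⟨q, qd, m, h1, h2, h3, h4⟩ := ih _ h'
      refine ⟨q, qd, m, ?_, ?_, ?_, ?_⟩
      · rw [he, h1]; simp only [charge, List.length_cons]; congr 1; omega
      · rw [he]; exact h2
      · intro z; rw [he, h3]; rfl
      · intro b hb hq
        exact h4 b (max_le hb (hq _ h.nodup)) hq

end Basic

section Tidy

variable {R : Type u} [Ring R] {X : Type v} {rank : X → ℕ} [Fintype X]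
  (kit : MatrixKit R) (d : ℕ)

/-- A bound for the memory. -/
def memBound (X : Type v) [Fintype X] (d : ℕ) : ℕ := 48 * ((Fintype.card X + 1) ^ 2 * (d + 1) ^ 2)

/-- The adjacency lists and the table of matrices are consistent and without repetitions, the
list of pairs is not too long, and the bounds for memory and registers have been kept. -/
structure Tidy (s : Store R X rank) : Prop where
  nodup_up : ∀ w, (s.up w).Nodup
  nodup_down : ∀ z, (s.down z).Nodup
  mem_up : ∀ w z, z ∈ s.up w ↔ (s.blk w z).isSome = true
  mem_down : ∀ w z, w ∈ s.down z ↔ (s.blk w z).isSome = true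
  nodup_queue : s.queue.Nodup
  length_pairs : s.pairs.length ≤ Fintype.card X
  mem_le : s.mem ≤ memBound X d
  work_le : s.work ≤ kit.opRegs d

variable {kit d}

theorem size_le_of_length (hd : ∀ x, rank x ≤ d) {s : Store R X rank}
    (hup : ∀ w, (s.up w).length ≤ Fintype.card X) (hdown : ∀ w, (s.down w).length ≤ Fintype.card X)
    (hq : s.queue.length ≤ Fintype.card X) (hp : s.pairs.length ≤ Fintype.card X) :
    s.size ≤ 32 * ((Fintype.card X + 1) ^ 2 * (d + 1) ^ 2) := by
  set n := Fintype.card X with hn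
  have h1 : ∑ x, (11 + 2 * (s.up x).length + 2 * (s.down x).length) ≤ n * (11 + 4 * n) := by
    refine (Finset.sum_le_card_nsmul _ _ (11 + 4 * n) fun x _ => ?_).trans (by simp [hn])
    have := hup x
    have := hdown x
    omega
  have h2 : ∑ x, ∑ y, (1 + if (s.blk x y).isSome then rank x * rank y else 0) ≤
      n * (n * (1 + d * d)) := by
    refine (Finset.sum_le_card_nsmul _ _ (n * (1 + d * d)) fun x _ => ?_).trans (by simp [hn])
    refine (Finset.sum_le_card_nsmul _ _ (1 + d * d) fun y _ => ?_).trans (by simp [hn])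
    have := Nat.mul_le_mul (hd x) (hd y)
    split_ifs <;> omega
  rw [Store.size]
  have h3 : 0 ≤ n * d := Nat.zero_le _
  have h4 : 0 ≤ n * n * d := Nat.zero_le _
  have h5 : 0 ≤ n * d * d := Nat.zero_le _
  nlinarith

theorem Tidy.size_le {s : Store R X rank} (h : s.Tidy kit d) (hd : ∀ x, rank x ≤ d) :
    s.size ≤ 32 * ((Fintype.card X + 1) ^ 2 * (d + 1) ^ 2) :=
  size_le_of_length hd (fun w => (h.nodup_up w).length_le_card)
    (fun w => (h.nodup_down w).length_le_card) h.nodup_queue.length_le_card h.length_pairs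

theorem Tidy.size_le_memBound {s : Store R X rank} (h : s.Tidy kit d) (hd : ∀ x, rank x ≤ d) :
    s.size ≤ memBound X d :=
  (h.size_le hd).trans (Nat.mul_le_mul_right _ (by norm_num))

theorem Tidy.charge {s : Store R X rank} (h : s.Tidy kit d) (hd : ∀ x, rank x ≤ d) (t : ℕ)
    {extra : ℕ} (he : extra ≤ 16 * ((Fintype.card X + 1) ^ 2 * (d + 1) ^ 2)) :
    (s.charge t extra).Tidy kit d :=
  ⟨h.1, h.2, h.3, h.4, h.5, h.6, max_le h.mem_le (by
    have := h.size_le hd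
    rw [memBound]; omega), h.8⟩

theorem Tidy.useWork {s : Store R X rank} (h : s.Tidy kit d) {r : ℕ} (hr : r ≤ kit.opRegs d) :
    (s.useWork r).Tidy kit d :=
  ⟨h.1, h.2, h.3, h.4, h.5, h.6, h.7, max_le h.work_le hr⟩

variable [DecidableEq X]

theorem Tidy.enqueue {s : Store R X rank} (h : s.Tidy kit d) (hd : ∀ x, rank x ≤ d)
    {dim : X → ℕ} {k : ℕ} (hq : s.QueueOK dim k) (l : List X) :
    (enqueue dim k l s).Tidy kit d := by
  obtain ⟨q, qd, m, h1, h2, -, h4⟩ := enqueue_spec dim k l s hq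
  have hn := h2.nodup
  rw [h1] at hn ⊢
  refine ⟨h.1, h.2, h.3, h.4, hn, h.6, h4 _ h.mem_le fun q' hq' => ?_, h.8⟩
  exact (size_le_of_length (s := { s with queue := q' }) hd
    (fun w => (h.nodup_up w).length_le_card) (fun w => (h.nodup_down w).length_le_card)
    hq'.length_le_card h.length_pairs).trans
    (Nat.mul_le_mul_right _ (by norm_num))

/-! ### Updating the matrices -/

variable (kit d) in
/-- `s` arises from `s₀` by the elimination step for `(x, y)` at the pairs in `Δ`. -/
structure BlkUpdate (x y : X) (B : Matrix (Fin (rank y)) (Fin (rank x)) R)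
    (s₀ : Store R X rank) (Δ : X → X → Prop) (s : Store R X rank) : Prop where
  tidy : s.Tidy kit d
  alive : s.alive = s₀.alive
  crit : s.crit = s₀.crit
  queued : s.queued = s₀.queued
  cnt : s.cnt = s₀.cnt
  queue : s.queue = s₀.queue
  pairs : s.pairs = s₀.pairs
  ne : ∀ w z, Δ w z → w ≠ x ∧ z ≠ y
  blk_of : ∀ w z, Δ w z →
    s.blk w z = some (s₀.getBlk w z - s₀.getBlk w y * B * s₀.getBlk x z)
  blk_of_not : ∀ w z, ¬ Δ w z → s.blk w z = s₀.blk w z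
  up_eq : ∀ w, (∀ z, ¬ Δ w z) → s.up w = s₀.up w

variable {x y : X} {B : Matrix (Fin (rank y)) (Fin (rank x)) R} {s₀ s : Store R X rank}
  {Δ : X → X → Prop}

theorem blk_setBlk_setCover (s : Store R X rank) (w z : X)
    (A : Matrix (Fin (rank w)) (Fin (rank z)) R) :
    (setBlk w z A (setCover w z s)).blk =
      Function.update s.blk w (Function.update (s.blk w) z (some A)) := by
  rw [setCover]; split_ifs <;> rfl

theorem blk_setBlk_setCover_of_ne (s : Store R X rank) (w z : X) (A : Matrix (Fin (rank w)) (Fin (rank z)) R)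
    {w' z' : X} (h : ¬ (w' = w ∧ z' = z)) :
    (setBlk w z A (setCover w z s)).blk w' z' = s.blk w' z' := by
  rw [blk_setBlk_setCover]
  by_cases hw : w' = w
  · subst hw
    have hz : z' ≠ z := fun e => h ⟨rfl, e⟩
    simp [hz]
  · simp [hw]

theorem Tidy.setBlk_setCover {s : Store R X rank} (h : s.Tidy kit d) (w z : X)
    (A : Matrix (Fin (rank w)) (Fin (rank z)) R) :
    (setBlk w z A (setCover w z s)).Tidy kit d := by
  have hself : (setBlk w z A (setCover w z s)).blk w z = some A := by
    rw [blk_setBlk_setCover]; simp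
  by_cases hb : (s.blk w z).isSome
  · have hs : setCover w z s = s := by rw [setCover, if_pos hb]
    rw [hs] at hself
    have hne : ∀ {w' z'}, ¬ (w' = w ∧ z' = z) →
        (setBlk w z A s).blk w' z' = s.blk w' z' := fun hne => by
      have := blk_setBlk_setCover_of_ne s w z A hne
      rwa [hs] at this
    have hiff : ∀ w' z', ((setBlk w z A s).blk w' z').isSome = (s.blk w' z').isSome := by
      intro w' z'
      by_cases he : w' = w ∧ z' = z
      · obtain ⟨rfl, rfl⟩ := he
        rw [hself, hb]; rfl
      · rw [hne he]
    rw [hs]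
    exact ⟨h.1, h.2, fun w' z' => by rw [hiff]; exact h.mem_up w' z',
      fun w' z' => by rw [hiff]; exact h.mem_down w' z', h.5, h.6, h.7, h.8⟩
  · have hup : (setBlk w z A (setCover w z s)).up = Function.update s.up w (s.up w ++ [z]) := by
      rw [setCover, if_neg hb]; rfl
    have hdown : (setBlk w z A (setCover w z s)).down =
        Function.update s.down z (s.down z ++ [w]) := by
      rw [setCover, if_neg hb]; rfl
    have hz : z ∉ s.up w := fun hm => hb ((h.mem_up w z).1 hm)
    have hw : w ∉ s.down z := fun hm => hb ((h.mem_down w z).1 hm)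
    have hrest : (setBlk w z A (setCover w z s)).queue = s.queue ∧
        (setBlk w z A (setCover w z s)).pairs = s.pairs ∧
        (setBlk w z A (setCover w z s)).mem = s.mem ∧
        (setBlk w z A (setCover w z s)).work = s.work := by
      rw [setCover, if_neg hb]; exact ⟨rfl, rfl, rfl, rfl⟩
    refine ⟨fun w' => ?_, fun z' => ?_, fun w' z' => ?_, fun w' z' => ?_, ?_, ?_, ?_, ?_⟩
    · rw [hup]
      by_cases he : w' = w
      · subst he
        rw [Function.update_self]
        simpa using List.Nodup.concat hz (h.nodup_up w')
      · rw [Function.update_of_ne he]; exact h.nodup_up w'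
    · rw [hdown]
      by_cases he : z' = z
      · subst he
        rw [Function.update_self]
        simpa using List.Nodup.concat hw (h.nodup_down z')
      · rw [Function.update_of_ne he]; exact h.nodup_down z'
    · by_cases he : w' = w ∧ z' = z
      · obtain ⟨rfl, rfl⟩ := he
        rw [hself, hup]; simp
      · rw [blk_setBlk_setCover_of_ne s w z A he, ← h.mem_up, hup]
        by_cases hw' : w' = w
        · subst hw'
          have : z' ≠ z := fun e => he ⟨rfl, e⟩
          simp [this]
        · simp [hw']
    · by_cases he : w' = w ∧ z' = z
      · obtain ⟨rfl, rfl⟩ := he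
        rw [hself, hdown]; simp
      · rw [blk_setBlk_setCover_of_ne s w z A he, ← h.mem_down, hdown]
        by_cases hz' : z' = z
        · subst hz'
          have : w' ≠ w := fun e => he ⟨e, rfl⟩
          simp [this]
        · simp [hz']
    · rw [hrest.1]; exact h.5
    · rw [hrest.2.1]; exact h.6
    · rw [hrest.2.2.1]; exact h.7
    · rw [hrest.2.2.2]; exact h.8

theorem setCover_fields (w z : X) (s : Store R X rank) :
    (setCover w z s).alive = s.alive ∧ (setCover w z s).crit = s.crit ∧
    (setCover w z s).queued = s.queued ∧ (setCover w z s).cnt = s.cnt ∧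
    (setCover w z s).queue = s.queue ∧ (setCover w z s).pairs = s.pairs ∧
    (setCover w z s).time = s.time ∧ ∀ w', w' ≠ w → (setCover w z s).up w' = s.up w' := by
  rw [setCover]
  split_ifs
  · simp
  · simp +contextual

theorem BlkUpdate.updateBlk (hd : ∀ x, rank x ≤ d) (h : BlkUpdate kit d x y B s₀ Δ s) {w z : X}
    (hΔ : ¬ Δ w z) (hw : w ≠ x) (hz : z ≠ y) {extra : ℕ}
    (he : extra ≤ 8 * ((Fintype.card X + 1) ^ 2 * (d + 1) ^ 2)) :
    BlkUpdate kit d x y B s₀ (fun w' z' => Δ w' z' ∨ (w' = w ∧ z' = z))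
      (Store.updateBlk kit x y B extra z w s) ∧
    (Store.updateBlk kit x y B extra z w s).time ≤ s.time + 4 * kit.opTime d := by
  have he₁ : MatrixKit.mulSize (rank w) (rank y) (rank x) ≤ d :=
    MatrixKit.mulSize_le (hd w) (hd y) (hd x)
  have he₂ : MatrixKit.mulSize (rank w) (rank x) (rank z) ≤ d :=
    MatrixKit.mulSize_le (hd w) (hd x) (hd z)
  have g1 : s.getBlk w y = s₀.getBlk w y := by
    rw [getBlk, getBlk, h.blk_of_not w y fun hc => (h.ne _ _ hc).2 rfl]
  have g2 : s.getBlk x z = s₀.getBlk x z := by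
    rw [getBlk, getBlk, h.blk_of_not x z fun hc => (h.ne _ _ hc).1 rfl]
  have g3 : s.getBlk w z = s₀.getBlk w z := by
    rw [getBlk, getBlk, h.blk_of_not w z hΔ]
  set s₁ := (s.useWork (kit.mulRegs (MatrixKit.mulSize (rank w) (rank y) (rank x)))).useWork
    (kit.mulRegs (MatrixKit.mulSize (rank w) (rank x) (rank z))) with hs₁
  set A := s₀.getBlk w z - s₀.getBlk w y * B * s₀.getBlk x z with hA
  have hupd : Store.updateBlk kit x y B extra z w s = (setBlk w z A (setCover w z s₁)).charge
      (kit.mulTime (rank w) (rank y) (rank x) + kit.mulTime (rank w) (rank x) (rank z)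
        + rank w * rank z + 3)
      (extra + rank w * rank x + rank w * rank z +
        2 * MatrixKit.mulSize (rank w) (rank y) (rank x) ^ 2 +
        2 * MatrixKit.mulSize (rank w) (rank x) (rank z) ^ 2) := by
    rw [hA, ← g1, ← g2, ← g3, ← kit.mulRect_eq, ← kit.mulRect_eq]
    rfl
  have hT₁ : s₁.Tidy kit d :=
    (h.tidy.useWork (kit.mulRegs_le he₁)).useWork (kit.mulRegs_le he₂)
  have hN : 1 ≤ (Fintype.card X + 1) ^ 2 := Nat.one_le_pow _ _ (Nat.succ_pos _)
  have hND : (d + 1) ^ 2 ≤ (Fintype.card X + 1) ^ 2 * (d + 1) ^ 2 := Nat.le_mul_of_pos_left _ hN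
  have hT : (Store.updateBlk kit x y B extra z w s).Tidy kit d := by
    rw [hupd]
    refine (hT₁.setBlk_setCover w z A).charge hd _ ?_
    have := mul_le_succ_sq (hd w) (hd x)
    have := mul_le_succ_sq (hd w) (hd z)
    have h3 := mul_le_succ_sq he₁ he₁
    have h4 := mul_le_succ_sq he₂ he₂
    rw [← sq] at h3 h4
    omega
  obtain ⟨f1, f2, f3, f4, f5, f6, f7, f8⟩ := setCover_fields w z s₁
  refine ⟨⟨hT, ?_, ?_, ?_, ?_, ?_, ?_, ?_, ?_, ?_, ?_⟩, ?_⟩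
  · rw [hupd]; exact f1.trans h.alive
  · rw [hupd]; exact f2.trans h.crit
  · rw [hupd]; exact f3.trans h.queued
  · rw [hupd]; exact f4.trans h.cnt
  · rw [hupd]; exact f5.trans h.queue
  · rw [hupd]; exact f6.trans h.pairs
  · rintro w' z' (h' | ⟨rfl, rfl⟩)
    · exact h.ne _ _ h'
    · exact ⟨hw, hz⟩
  · rw [hupd]
    intro w' z' h'
    change (setBlk w z A (setCover w z s₁)).blk w' z' = _
    by_cases e : w' = w ∧ z' = z
    · obtain ⟨rfl, rfl⟩ := e
      rw [blk_setBlk_setCover]; simp [hA]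
    · rw [blk_setBlk_setCover_of_ne _ _ _ _ e]
      exact h.blk_of _ _ (h'.resolve_right e)
  · rw [hupd]
    intro w' z' h'
    change (setBlk w z A (setCover w z s₁)).blk w' z' = _
    rw [blk_setBlk_setCover_of_ne _ _ _ _ fun e => h' (Or.inr e)]
    exact h.blk_of_not _ _ fun e => h' (Or.inl e)
  · rw [hupd]
    intro w' h'
    have hne : w' ≠ w := by
      rintro rfl; exact h' z (Or.inr ⟨rfl, rfl⟩)
    exact (f8 w' hne).trans (h.up_eq w' fun z' hz' => h' z' (Or.inl hz'))
  · rw [hupd]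
    change (setCover w z s₁).time + _ ≤ _
    rw [f7]
    have h1 := kit.mulTime_le (hd w) (hd y) (hd x)
    have h2 := kit.mulTime_le (hd w) (hd x) (hd z)
    have h3 := kit.mul_add_two_le_opTime (hd w) (hd z)
    change s.time + _ ≤ _
    omega

theorem BlkUpdate.congr (h : BlkUpdate kit d x y B s₀ Δ s) {Δ' : X → X → Prop}
    (hΔ : ∀ w z, Δ w z ↔ Δ' w z) : BlkUpdate kit d x y B s₀ Δ' s := by
  have : Δ = Δ' := by ext w z; exact hΔ w z
  exact this ▸ h

theorem BlkUpdate.foldl_row (hd : ∀ x, rank x ≤ d) {z : X} (hz : z ≠ y) {extra : ℕ}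
    (he : extra ≤ 8 * ((Fintype.card X + 1) ^ 2 * (d + 1) ^ 2)) (ws : List X) (hws : ws.Nodup)
    (hx : x ∉ ws) (h : BlkUpdate kit d x y B s₀ Δ s) (hΔ : ∀ w ∈ ws, ¬ Δ w z) :
    BlkUpdate kit d x y B s₀ (fun w' z' => Δ w' z' ∨ (w' ∈ ws ∧ z' = z))
      (ws.foldl (fun s w => Store.updateBlk kit x y B extra z w s) s) ∧
    (ws.foldl (fun s w => Store.updateBlk kit x y B extra z w s) s).time ≤
      s.time + ws.length * (4 * kit.opTime d) := by
  induction ws generalizing s Δ with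
  | nil => exact ⟨h.congr (by simp), by simp⟩
  | cons w ws ih =>
    rw [List.nodup_cons] at hws
    rw [List.mem_cons, not_or] at hx
    obtain ⟨h1, h2⟩ := h.updateBlk hd (hΔ w (by simp)) (Ne.symm hx.1) hz he
    obtain ⟨h3, h4⟩ := ih hws.2 hx.2 h1 (by
      rintro w' hw' (h' | ⟨rfl, -⟩)
      · exact hΔ w' (by simp [hw']) h'
      · exact hws.1 hw')
    refine ⟨h3.congr fun w' z' => ?_, ?_⟩
    · simp only [List.mem_cons]; tauto
    · rw [List.foldl_cons, List.length_cons]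
      refine h4.trans ?_
      linarith

theorem BlkUpdate.charge (hd : ∀ x, rank x ≤ d) (h : BlkUpdate kit d x y B s₀ Δ s) (t : ℕ)
    {extra : ℕ} (he : extra ≤ 8 * ((Fintype.card X + 1) ^ 2 * (d + 1) ^ 2)) :
    BlkUpdate kit d x y B s₀ Δ (s.charge t extra) :=
  ⟨h.tidy.charge hd t (he.trans (Nat.mul_le_mul_right _ (by norm_num))), h.alive, h.crit, h.queued,
    h.cnt, h.queue, h.pairs, h.ne, h.blk_of, h.blk_of_not, h.up_eq⟩

theorem BlkUpdate.foldl_rows (hd : ∀ x, rank x ≤ d) {extra : ℕ}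
    (he : extra ≤ 8 * ((Fintype.card X + 1) ^ 2 * (d + 1) ^ 2)) (ws : List X) (hws : ws.Nodup)
    (hx : x ∉ ws) (zs : List X) (hzs : zs.Nodup) (hy : y ∉ zs)
    (h : BlkUpdate kit d x y B s₀ Δ s) (hΔ : ∀ z ∈ zs, ∀ w ∈ ws, ¬ Δ w z) :
    BlkUpdate kit d x y B s₀ (fun w' z' => Δ w' z' ∨ (w' ∈ ws ∧ z' ∈ zs))
      (zs.foldl (fun s z => ws.foldl (fun s w => Store.updateBlk kit x y B extra z w s)
        (s.charge 1 extra)) s) ∧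
    (zs.foldl (fun s z => ws.foldl (fun s w => Store.updateBlk kit x y B extra z w s)
        (s.charge 1 extra)) s).time ≤
      s.time + zs.length * (1 + ws.length * (4 * kit.opTime d)) := by
  induction zs generalizing s Δ with
  | nil => exact ⟨h.congr (by simp), by simp⟩
  | cons z zs ih =>
    rw [List.nodup_cons] at hzs
    rw [List.mem_cons, not_or] at hy
    obtain ⟨h1, h2⟩ := (h.charge hd 1 he).foldl_row hd (Ne.symm hy.1) he ws hws hx
      (hΔ z (by simp))
    obtain ⟨h3, h4⟩ := ih hzs.2 hy.2 h1 (by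
      rintro z' hz' w' hw' (h' | ⟨-, rfl⟩)
      · exact hΔ z' (by simp [hz']) w' hw' h'
      · exact hzs.1 hz')
    refine ⟨h3.congr fun w' z' => ?_, ?_⟩
    · simp only [List.mem_cons]; tauto
    · rw [List.foldl_cons, List.length_cons]
      refine h4.trans ?_
      have : (s.charge 1 extra).time = s.time + 1 := rfl
      rw [this] at h2
      linarith

theorem reducePair_spec (hd : ∀ x, rank x ≤ d) (hT : s.Tidy kit d) {low : List X}
    (hlow : low.Nodup) (hp : s.pairs.length + 1 ≤ Fintype.card X) :
    ∃ s₁ t m, BlkUpdate kit d x y B s (fun w z => (w ∈ low ∧ w ≠ x) ∧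
        (z ∈ s.up x ∧ s.alive z = true ∧ z ≠ y)) s₁ ∧
      reducePair kit x y B low s = { s₁ with
        alive := Function.update (Function.update s.alive x false) y false
        cnt := fun z => s.cnt z - (s₁.up x).count z - (s₁.up y).count z
        pairs := (x, y) :: s.pairs
        time := t
        mem := m } ∧
      (reducePair kit x y B low s).Tidy kit d ∧
      t ≤ s.time + ((s.up x).length + low.length + (s₁.up x).length + (s₁.up y).length + 4) +
        (s.up x).length * (1 + (low.filter fun w => decide (w ≠ x)).length *
          (4 * kit.opTime d)) := by
  set zs := (s.up x).filter fun z => s.alive z && decide (z ≠ y) with hzs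
  set ws := low.filter fun w => decide (w ≠ x) with hws
  set extra := 2 * zs.length + 2 * ws.length + 2 * low.length + rank y * rank x with hextra
  have hzn : zs.Nodup := (hT.nodup_up x).filter _
  have hwn : ws.Nodup := hlow.filter _
  have he : extra ≤ 8 * ((Fintype.card X + 1) ^ 2 * (d + 1) ^ 2) := by
    have h1 := hzn.length_le_card
    have h2 := hwn.length_le_card
    have h3 := hlow.length_le_card
    have h4 := mul_le_succ_sq (hd y) (hd x)
    have hN : 1 ≤ (Fintype.card X + 1) ^ 2 := Nat.one_le_pow _ _ (Nat.succ_pos _)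
    have hD : 1 ≤ (d + 1) ^ 2 := Nat.one_le_pow _ _ (Nat.succ_pos _)
    have h5 : (d + 1) ^ 2 ≤ (Fintype.card X + 1) ^ 2 * (d + 1) ^ 2 := Nat.le_mul_of_pos_left _ hN
    have h6 : Fintype.card X ≤ (Fintype.card X + 1) ^ 2 := by nlinarith
    have h7 := h6.trans (Nat.le_mul_of_pos_right ((Fintype.card X + 1) ^ 2) hD)
    omega
  have h0 : BlkUpdate kit d x y B s (fun _ _ => False) s :=
    ⟨hT, rfl, rfl, rfl, rfl, rfl, rfl, fun _ _ h => h.elim, fun _ _ h => h.elim,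
      fun _ _ _ => rfl, fun _ _ => rfl⟩
  obtain ⟨h1, h2⟩ := (h0.charge hd ((s.up x).length + low.length + 1) he).foldl_rows hd he ws hwn
    (by simp [hws]) zs hzn (by simp [hzs]) (by simp)
  set s₁ := zs.foldl (fun s z => ws.foldl
    (fun s w => Store.updateBlk kit x y B extra z w s) (s.charge 1 extra))
    (s.charge ((s.up x).length + low.length + 1) extra) with hs₁
  have hred : reducePair kit x y B low s =
      ({ remove y (remove x s₁) with pairs := (x, y) :: (remove y (remove x s₁)).pairs }).charge
        1 0 := rfl
  rw [remove_eq, remove_eq] at hred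
  have hm : s₁.mem ≤ memBound X d := h1.tidy.mem_le
  have hsz := h1.tidy.size_le_memBound hd
  refine ⟨s₁, s₁.time + 1 + (s₁.up x).length + 1 + (s₁.up y).length + 1,
    (reducePair kit x y B low s).mem, h1.congr fun w z => ?_, ?_, ?_, ?_⟩
  · simp [hws, hzs]
  · rw [hred, h1.alive, h1.cnt, h1.pairs]; rfl
  · rw [hred]
    have hlen : ((x, y) :: s₁.pairs).length ≤ Fintype.card X := by
      rw [h1.pairs]; exact hp
    refine ⟨h1.tidy.1, h1.tidy.2, h1.tidy.3, h1.tidy.4, h1.tidy.5, hlen, ?_, h1.tidy.8⟩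
    refine max_le (max_le (max_le hm hsz) hsz) ?_
    exact (size_le_of_length (s := { s₁ with pairs := (x, y) :: s₁.pairs }) hd
      (fun w => (h1.tidy.nodup_up w).length_le_card)
      (fun w => (h1.tidy.nodup_down w).length_le_card) h1.tidy.nodup_queue.length_le_card
      hlen).trans (Nat.mul_le_mul_right _ (by norm_num))
  · have h3 : zs.length ≤ (s.up x).length := List.length_filter_le _ _
    have h4 : (s.charge ((s.up x).length + low.length + 1) extra).time =
      s.time + ((s.up x).length + low.length + 1) := rfl
    rw [h4] at h2
    have h5 := Nat.mul_le_mul_right (1 + ws.length * (4 * kit.opTime d)) h3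
    omega

end Tidy

end Store

/-! ### The invariant of the algorithm -/

namespace Store

variable {R : Type u} [Ring R] {X : Type v} [PartialOrder X] [Fintype X] [DecidableEq X]
  (I : Input.{u, v, w} R X) (kit : MatrixKit R)

/-- The invariant: the pairs reduced so far form a reduction sequence, the present elements are
those it leaves unmatched, and the stored covering relation and matrices between them are those of
its Morse data. Elements that are not marked as critical still have their original covers. -/
structure Inv (s : Store R X I.rank) : Prop where
  tidy : s.Tidy kit I.maxRank
  up_eq : ∀ w, s.crit w = false → s.up w = I.up w
  crit_alive : ∀ x, s.crit x = true → s.alive x = true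
  alive_iff : ∀ x, s.alive x = true ↔ IsCritical {r | r ∈ s.pairs} x
  seq : IsReductionSeq I.F.toBlockData s.pairs
  free : ∀ x, s.alive x = true → s.crit x = false → ∀ r ∈ s.pairs, ¬ x ⋖ r.2
  dim_blk : ∀ w z, (s.blk w z).isSome = true → I.dim z = I.dim w + 1
  covers : ∀ w z, s.alive w = true → s.alive z = true →
    ((s.blk w z).isSome = true ↔ MorseCovers {r | r ∈ s.pairs} w z)
  getBlk_eq : ∀ w z, s.alive w = true → s.alive z = true →
    s.getBlk w z = I.matrixOf (morseMap I.F.toBlockData {r | r ∈ s.pairs} w z)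
  cnt_eq : ∀ z, s.cnt z = Set.ncard {x | x ⋖ z ∧ s.alive x = true ∧ s.crit x = false}

variable {I kit} {s : Store R X I.rank}

theorem Inv.bookkeeping (h : s.Inv I kit) {q : List X} {qd : X → Bool} {t m k : ℕ}
    (hT : ({ s with queue := q, queued := qd, time := t, mem := m, work := k }).Tidy kit
      I.maxRank) :
    ({ s with queue := q, queued := qd, time := t, mem := m, work := k }).Inv I kit :=
  ⟨hT, h.2, h.3, h.4, h.5, h.6, h.7, h.8, h.9, h.10⟩

theorem Inv.charge (h : s.Inv I kit) (t : ℕ) {extra : ℕ}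
    (he : extra ≤ 16 * ((Fintype.card X + 1) ^ 2 * (I.maxRank + 1) ^ 2)) :
    (s.charge t extra).Inv I kit :=
  h.bookkeeping (h.tidy.charge I.rank_le t he)

theorem Inv.useWork (h : s.Inv I kit) {r : ℕ} (hr : r ≤ kit.opRegs I.maxRank) :
    (s.useWork r).Inv I kit :=
  h.bookkeeping (h.tidy.useWork hr)

theorem Inv.enqueue (h : s.Inv I kit) {k : ℕ} (hq : s.QueueOK I.dim k) (l : List X) :
    (enqueue I.dim k l s).Inv I kit := by
  have hT := h.tidy.enqueue I.rank_le hq l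
  obtain ⟨q, qd, m, h1, -⟩ := enqueue_spec I.dim k l s hq
  rw [h1] at hT ⊢
  exact h.bookkeeping hT

theorem Inv.mem_down_iff (h : s.Inv I kit) {x y : X} (hx : s.crit x = false) :
    x ∈ s.down y ↔ x ⋖ y := by
  rw [h.tidy.mem_down, ← h.tidy.mem_up, h.up_eq x hx, I.mem_up]

theorem count_up (a z : X) [Decidable (a ⋖ z)] :
    (I.up a).count z = if a ⋖ z then 1 else 0 := by
  split_ifs with h
  · exact List.count_eq_one_of_mem (I.nodup_up a) ((I.mem_up a z).2 h)
  · exact List.count_eq_zero_of_not_mem fun hm => h ((I.mem_up a z).1 hm)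

/-- Removing an element from those counted below `z`. -/
theorem ncard_sub_count_up (P : X → Prop) {a : X} (ha : P a) (z : X) :
    Set.ncard {x | x ⋖ z ∧ P x} - (I.up a).count z = Set.ncard {x | x ⋖ z ∧ P x ∧ x ≠ a} := by
  classical
  have hset : {x | x ⋖ z ∧ P x ∧ x ≠ a} = {x | x ⋖ z ∧ P x} \ {a} := by
    ext x; simp [and_assoc]
  rw [hset, count_up]
  split_ifs with h
  · rw [Set.ncard_sdiff_singleton_of_mem (show a ∈ {x | x ⋖ z ∧ P x} from ⟨h, ha⟩)]
  · rw [Set.sdiff_singleton_eq_self (show a ∉ {x | x ⋖ z ∧ P x} from fun hc => h hc.1)]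
    rfl

theorem Inv.mark (h : s.Inv I kit) {c : X} (hal : s.alive c = true) (hcr : s.crit c = false) :
    (mark c s).Inv I kit := by
  rw [mark_eq]
  have hcrit : ∀ w, Function.update s.crit c true w = false ↔ s.crit w = false ∧ w ≠ c := by
    intro w
    by_cases hw : w = c
    · subst hw; simp
    · simp [hw]
  refine ⟨⟨h.tidy.1, h.tidy.2, h.tidy.3, h.tidy.4, h.tidy.5, h.tidy.6,
    max_le h.tidy.7 (h.tidy.size_le_memBound I.rank_le), h.tidy.8⟩,
    fun w hw => h.up_eq w ((hcrit w).1 hw).1, fun x hx => ?_, h.alive_iff, h.seq,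
    fun x hx hx' => h.free x hx ((hcrit x).1 hx').1, h.dim_blk, h.covers, h.getBlk_eq,
    fun z => ?_⟩
  · by_cases hxc : x = c
    · subst hxc; exact hal
    · exact h.crit_alive x (by simpa [hxc] using hx)
  · change s.cnt z - (s.up c).count z = Set.ncard {x | x ⋖ z ∧ s.alive x = true ∧
      Function.update s.crit c true x = false}
    rw [h.cnt_eq, h.up_eq c hcr,
      ncard_sub_count_up (fun x => s.alive x = true ∧ s.crit x = false) ⟨hal, hcr⟩]
    simp only [hcrit, and_assoc]

/-- The number of critical elements of dimension `k`. -/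
def critCount (dim : X → ℕ) (crit : X → Bool) (k : ℕ) : ℕ :=
  (Finset.univ.filter fun x => crit x = true ∧ dim x = k).card

theorem length_le_critCount {dim : X → ℕ} {crit : X → Bool} {k : ℕ} {l : List X} (hl : l.Nodup)
    (h : ∀ x ∈ l, crit x = true ∧ dim x = k) : l.length ≤ critCount dim crit k := by
  rw [← List.toFinset_card_of_nodup hl]
  exact Finset.card_le_card fun x hx => by simpa using h x (List.mem_toFinset.1 hx)

theorem Inv.length_down_le (h : s.Inv I kit) {k : ℕ} {y : X} (hy : I.dim y = k + 1) :
    (s.down y).length ≤ (I.down y).length + critCount I.dim s.crit k := by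
  rw [List.length_eq_length_filter_add (l := s.down y) (fun x => !s.crit x)]
  refine Nat.add_le_add (List.Subperm.length_le
    (List.subperm_of_subset ((h.tidy.nodup_down y).filter _) fun x hx => ?_))
    (length_le_critCount ((h.tidy.nodup_down y).filter _) fun x hx => ?_)
  · obtain ⟨h1, h2⟩ := List.mem_filter.1 hx
    exact (I.mem_down x y).2 ((h.mem_down_iff (by simpa using h2)).1 h1)
  · obtain ⟨h1, h2⟩ := List.mem_filter.1 hx
    have := h.dim_blk x y ((h.tidy.mem_down x y).1 h1)
    exact ⟨by simpa using h2, by omega⟩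

/-- The invariant is preserved by `ReducePair`. -/
theorem Inv.reducePair (h : s.Inv I kit) {x y : X} (hx : s.alive x = true)
    (hy : s.alive y = true) (hxc : s.crit x = false) (hyc : s.crit y = false)
    (hxy : x ∈ s.down y) (honly : ∀ w ∈ s.down y, s.alive w = true → s.crit w = false → w = x)
    {low : List X} (hlow : low.Nodup)
    (hmem : ∀ w, w ∈ low ↔ w ∈ s.down y ∧ s.alive w = true)
    {B : Matrix (Fin (I.rank y)) (Fin (I.rank x)) R} (hB : kit.invRect (s.getBlk x y) = some B) :
    (reducePair kit x y B low s).Inv I kit ∧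
    (reducePair kit x y B low s).crit = s.crit ∧
    (reducePair kit x y B low s).queue = s.queue ∧
    (reducePair kit x y B low s).queued = s.queued ∧
    (∀ z, s.alive z = true → z ≠ x → z ≠ y → (reducePair kit x y B low s).alive z = true) ∧
    (reducePair kit x y B low s).time ≤ s.time + (3 * maxCovers X + low.length + 4) +
      maxCovers X * (1 + critCount I.dim s.crit (I.dim x) * (4 * kit.opTime I.maxRank)) := by
  have hcov : x ⋖ y := (h.mem_down_iff hxc).1 hxy
  have hfree := h.free x hx hxc
  have hmorse : morseMap I.F.toBlockData {r | r ∈ s.pairs} x y = I.F.map x y :=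
    morseMap_of_free (S := {r | r ∈ s.pairs}) _ hfree y
  obtain ⟨hAB, hBA⟩ := kit.invRect_eq_some hB
  rw [h.getBlk_eq x y hx hy] at hAB hBA
  obtain ⟨hbij, hinv⟩ := I.bijective_and_matrixOf_linInv hAB hBA
  have hseq : IsReductionSeq I.F.toBlockData ((x, y) :: s.pairs) :=
    ⟨h.seq, hcov, hmorse ▸ hbij, (h.alive_iff x).1 hx, (h.alive_iff y).1 hy, hfree⟩
  have hlen : s.pairs.length + 1 ≤ Fintype.card X := by
    simpa using hseq.nodup_map_fst.length_le_card
  obtain ⟨s₁, t, m, hU, heq, hT, ht⟩ :=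
    reducePair_spec (x := x) (y := y) (B := B) I.rank_le h.tidy hlow hlen
  have hws : ∀ w, w ∈ low ∧ w ≠ x → s.crit w = true := by
    rintro w ⟨hw, hne⟩
    obtain ⟨h1, h2⟩ := (hmem w).1 hw
    by_contra hc
    exact hne (honly w h1 h2 (by simpa using hc))
  have hup : ∀ w, s.crit w = false → s₁.up w = I.up w := by
    intro w hw
    rw [hU.up_eq w fun z hz => by simp [hws w hz.1] at hw, h.up_eq w hw]
  rw [heq] at hT ⊢
  have halive : ∀ z, Function.update (Function.update s.alive x false) y false z = true ↔
      s.alive z = true ∧ z ≠ x ∧ z ≠ y := by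
    intro z
    by_cases hzy : z = y
    · subst hzy; simp
    · by_cases hzx : z = x
      · subst hzx; simp [hzy]
      · simp [hzx, hzy]
  have hisSome : ∀ w z, (s₁.blk w z).isSome = true ↔ (s.blk w z).isSome = true ∨
      ((w ∈ low ∧ w ≠ x) ∧ (z ∈ s.up x ∧ s.alive z = true ∧ z ≠ y)) := by
    intro w z
    by_cases hΔ : (w ∈ low ∧ w ≠ x) ∧ (z ∈ s.up x ∧ s.alive z = true ∧ z ≠ y)
    · rw [hU.blk_of w z hΔ]; exact ⟨fun _ => Or.inr hΔ, fun _ => rfl⟩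
    · rw [hU.blk_of_not w z hΔ]
      exact ⟨Or.inl, fun hc => hc.resolve_right hΔ⟩
  refine ⟨⟨hT, ?_, ?_, ?_, hseq, ?_, ?_, ?_, ?_, ?_⟩, hU.crit, hU.queue, hU.queued, ?_, ?_⟩
  · intro w hw
    exact hup w (by rw [← hU.crit]; exact hw)
  · intro z hz
    change s₁.crit z = true at hz
    rw [hU.crit] at hz
    refine (halive z).2 ⟨h.crit_alive z hz, ?_, ?_⟩
    · rintro rfl; simp [hxc] at hz
    · rintro rfl; simp [hyc] at hz
  · intro z
    change Function.update (Function.update s.alive x false) y false z = true ↔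
      IsCritical {r | r ∈ (x, y) :: s.pairs} z
    rw [halive, setOf_mem_cons, isCritical_insert, h.alive_iff]
  · intro z hz hzc r hr hzr
    change s₁.crit z = false at hzc
    rw [hU.crit] at hzc
    obtain ⟨h1, h2, h3⟩ := (halive z).1 hz
    rcases List.mem_cons.1 hr with rfl | hr
    · exact h2 (honly z ((h.mem_down_iff hzc).2 hzr) h1 hzc)
    · exact h.free z h1 hzc r hr hzr
  · intro w z hwz
    rcases (hisSome w z).1 hwz with hwz | ⟨⟨hw, -⟩, hz, -⟩
    · exact h.dim_blk w z hwz
    · have h1 := h.dim_blk w y ((h.tidy.mem_down w y).1 ((hmem w).1 hw).1)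
      have h2 := h.dim_blk x z ((h.tidy.mem_up x z).1 hz)
      have h3 := I.dim_covBy x y hcov
      omega
  · intro w z hw hz
    obtain ⟨hw, hwx, -⟩ := (halive w).1 hw
    obtain ⟨hz, -, hzy⟩ := (halive z).1 hz
    change (s₁.blk w z).isSome = true ↔ MorseCovers {r | r ∈ (x, y) :: s.pairs} w z
    rw [hisSome, hseq.morseCovers_cons, ← h.covers w z hw hz, ← h.covers x z hx hz,
      ← h.covers w y hw hy, hmem, h.tidy.mem_up, h.tidy.mem_down]
    tauto
  · intro w z hw hz
    obtain ⟨hw, hwx, -⟩ := (halive w).1 hw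
    obtain ⟨hz, -, hzy⟩ := (halive z).1 hz
    change s₁.getBlk w z = I.matrixOf (morseMap I.F.toBlockData {r | r ∈ (x, y) :: s.pairs} w z)
    have hnew : s₁.getBlk w z = s.getBlk w z - s.getBlk w y * B * s.getBlk x z := by
      by_cases hΔ : (w ∈ low ∧ w ≠ x) ∧ (z ∈ s.up x ∧ s.alive z = true ∧ z ≠ y)
      · rw [getBlk, hU.blk_of w z hΔ, Option.getD_some]
      · rw [getBlk, hU.blk_of_not w z hΔ, ← getBlk]
        have hzero : s.blk w y = none ∨ s.blk x z = none := by
          by_contra! hc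
          refine hΔ ⟨⟨(hmem w).2 ⟨(h.tidy.mem_down w y).2 ?_, hw⟩, hwx⟩,
            (h.tidy.mem_up x z).2 ?_, hz, hzy⟩
          · exact Option.isSome_iff_ne_none.2 hc.1
          · exact Option.isSome_iff_ne_none.2 hc.2
        rcases hzero with h0 | h0
        · rw [getBlk, getBlk, h0]; simp
        · rw [getBlk, getBlk, getBlk, h0]; simp
    rw [hnew, hseq.morseMap_cons I.F.map_eq_zero, I.matrixOf_sub, I.matrixOf_comp,
      I.matrixOf_comp, hinv, h.getBlk_eq w z hw hz, h.getBlk_eq w y hw hy, h.getBlk_eq x z hx hz]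
  · intro z
    change s.cnt z - (s₁.up x).count z - (s₁.up y).count z = Set.ncard {w | w ⋖ z ∧
      Function.update (Function.update s.alive x false) y false w = true ∧ s₁.crit w = false}
    rw [hup x hxc, hup y hyc, h.cnt_eq,
      ncard_sub_count_up (fun w => s.alive w = true ∧ s.crit w = false) ⟨hx, hxc⟩,
      ncard_sub_count_up (fun w => (s.alive w = true ∧ s.crit w = false) ∧ w ≠ x)
        ⟨⟨hy, hyc⟩, hcov.lt.ne'⟩]
    congr 1
    ext w
    simp only [Set.mem_ofPred_eq, halive, hU.crit]
    tauto
  · intro z h1 h2 h3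
    exact (halive z).2 ⟨h1, h2, h3⟩
  · change t ≤ _
    refine ht.trans ?_
    rw [hup x hxc, hup y hyc, h.up_eq x hxc]
    have h1 := I.length_up_le x
    have h2 := I.length_up_le y
    have h3 : (low.filter fun w => decide (w ≠ x)).length ≤ critCount I.dim s.crit (I.dim x) := by
      refine length_le_critCount (hlow.filter _) fun w hw => ?_
      obtain ⟨hw, hne⟩ := List.mem_filter.1 hw
      have hd := h.dim_blk w y ((h.tidy.mem_down w y).1 ((hmem w).1 hw).1)
      have := I.dim_covBy x y hcov
      exact ⟨hws w ⟨hw, by simpa using hne⟩, by omega⟩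
    refine Nat.add_le_add (by omega) (Nat.mul_le_mul h1 ?_)
    exact Nat.add_le_add_left (Nat.mul_le_mul_right _ h3) _

/-! ### One pass of the inner loop -/

variable (I kit) in
/-- A bound for the time of the pass of the inner loop for `y`, in terms of the number `M` of
critical elements one dimension below. -/
def passCost (M : ℕ) (y : X) : ℕ :=
  3 * (I.down y).length + 20 * ((maxCovers X + 1) * (M + 1) * kit.opTime I.maxRank)

theorem exists_process_eq (kit : MatrixKit R) (dim : X → ℕ) (k : ℕ) (y : X) {rank : X → ℕ}
    (s : Store R X rank) {low nonCrit : List X} (hlow : (s.down y).filter (fun x => s.alive x) = low)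
    (hnonCrit : low.filter (fun x => !s.crit x) = nonCrit) {extra : ℕ}
    (hextra : 2 * low.length + 2 * nonCrit.length = extra) {s₁ : Store R X rank}
    (hs₁ : s.charge ((s.down y).length + low.length + 1) extra = s₁) :
    ∃ s₂, process kit dim k y s = Store.enqueue dim k (s₂.up y) s₂ ∧
      (s₂ = s₁ ∨ ∃ x s₃, nonCrit = [x] ∧
        s₃ = (s₁.useWork (kit.invRegs (rank x) (rank y))).charge
          (kit.invTime (rank x) (rank y)) (extra + 2 * (rank x * rank y)) ∧
        (s₂ = s₃ ∨ ∃ B, kit.invRect (s.getBlk x y) = some B ∧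
          s₂ = Store.reducePair kit x y B low (Store.enqueue dim k (s.up x) s₃))) := by
  subst hlow hnonCrit hextra hs₁
  refine ⟨_, rfl, ?_⟩
  split
  next x hx =>
    refine Or.inr ⟨x, _, hx, rfl, ?_⟩
    dsimp only
    split
    next B hB => exact Or.inr ⟨B, hB, rfl⟩
    next => exact Or.inl rfl
  next => exact Or.inl rfl

theorem QueueOK.congr {rank : X → ℕ} {s s' : Store R X rank} {dim : X → ℕ} {k : ℕ}
    (h : s.QueueOK dim k) (h1 : s'.queue = s.queue) (h2 : s'.queued = s.queued)
    (h3 : ∀ z ∈ s.queue, s'.alive z = true) (h4 : s'.crit = s.crit) : s'.QueueOK dim k :=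
  ⟨h1 ▸ h.nodup, by rw [h1, h2]; exact h.queued, by rw [h1]; exact h3,
    by rw [h1, h4]; exact h.crit, by rw [h1]; exact h.dim⟩

theorem Inv.process (h : s.Inv I kit) {k : ℕ} (hq : s.QueueOK I.dim k) {y : X}
    (hy : s.alive y = true) (hyc : s.crit y = false) (hyd : I.dim y = k + 1)
    (hyq : y ∉ s.queue) (hyqd : s.queued y = true) :
    (process kit I.dim k y s).Inv I kit ∧ (process kit I.dim k y s).QueueOK I.dim k ∧
    (process kit I.dim k y s).crit = s.crit ∧
    (∀ z, (process kit I.dim k y s).Pending z ↔ s.Pending z) ∧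
    (process kit I.dim k y s).time + 1 ≤
      s.time + passCost I kit (critCount I.dim s.crit k) y := by
  set low := (s.down y).filter fun x => s.alive x with hlow
  set nonCrit := low.filter fun x => !s.crit x with hnonCrit
  set extra := 2 * low.length + 2 * nonCrit.length with hextra
  set s₁ := s.charge ((s.down y).length + low.length + 1) extra with hs₁
  have hlown : low.Nodup := (h.tidy.nodup_down y).filter _
  have hnc : nonCrit.Nodup := hlown.filter _
  set p := maxCovers X with hp
  set M := critCount I.dim s.crit k with hM
  set T := kit.opTime I.maxRank with hTdef
  have hT2 : 2 ≤ T := by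
    simpa using kit.mul_add_two_le_opTime (d := I.maxRank) (Nat.zero_le I.maxRank)
      (Nat.zero_le I.maxRank)
  have hlowlen : low.length ≤ (s.down y).length := List.length_filter_le _ _
  have hdown := h.length_down_le hyd
  have hND : 1 ≤ (Fintype.card X + 1) ^ 2 ∧ 1 ≤ (I.maxRank + 1) ^ 2 :=
    ⟨Nat.one_le_pow _ _ (Nat.succ_pos _), Nat.one_le_pow _ _ (Nat.succ_pos _)⟩
  have hbig1 : (I.maxRank + 1) ^ 2 ≤ (Fintype.card X + 1) ^ 2 * (I.maxRank + 1) ^ 2 :=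
    Nat.le_mul_of_pos_left _ hND.1
  have hbig2 : Fintype.card X ≤ (Fintype.card X + 1) ^ 2 * (I.maxRank + 1) ^ 2 :=
    le_trans (by nlinarith) (Nat.le_mul_of_pos_right ((Fintype.card X + 1) ^ 2) hND.2)
  have hextra4 : extra ≤ 4 * Fintype.card X := by
    have h1 := hlown.length_le_card
    have h2 := hnc.length_le_card
    omega
  have hI₁ : s₁.Inv I kit := h.charge _ (by omega)
  have hQ₁ : s₁.QueueOK I.dim k := hq.congr rfl rfl hq.alive rfl
  have hA : 1 ≤ (p + 1) * (M + 1) := Nat.mul_pos (Nat.succ_pos _) (Nat.succ_pos _)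
  have hcost : 3 * M + T + 6 * p + 6 + p * (M * (4 * T)) ≤ 20 * ((p + 1) * (M + 1) * T) := by
    have e1 : M ≤ (p + 1) * (M + 1) * T := by nlinarith [Nat.zero_le (p * M)]
    have e2 : T ≤ (p + 1) * (M + 1) * T := Nat.le_mul_of_pos_left _ hA
    have e3 : p ≤ (p + 1) * (M + 1) * T := by nlinarith [Nat.zero_le (p * M)]
    have e4 : 1 ≤ (p + 1) * (M + 1) * T := by nlinarith
    have e5 : p * (M * (4 * T)) ≤ 4 * ((p + 1) * (M + 1) * T) := by
      have : p * M ≤ (p + 1) * (M + 1) := Nat.mul_le_mul (by omega) (by omega)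
      nlinarith
    omega
  have hpass : passCost I kit M y = 3 * (I.down y).length + 20 * ((p + 1) * (M + 1) * T) := rfl
  suffices key : ∀ s₂ : Store R X I.rank, s₂.Inv I kit → s₂.QueueOK I.dim k → s₂.crit = s.crit →
      (∀ z, s₂.Pending z ↔ s.Pending z) →
      s₂.time + p + 1 ≤ s.time + passCost I kit M y →
      (Store.enqueue I.dim k (s₂.up y) s₂).Inv I kit ∧
      (Store.enqueue I.dim k (s₂.up y) s₂).QueueOK I.dim k ∧
      (Store.enqueue I.dim k (s₂.up y) s₂).crit = s.crit ∧
      (∀ z, (Store.enqueue I.dim k (s₂.up y) s₂).Pending z ↔ s.Pending z) ∧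
      (Store.enqueue I.dim k (s₂.up y) s₂).time + 1 ≤ s.time + passCost I kit M y by
    obtain ⟨s₂, heq, hs₂⟩ := exists_process_eq kit I.dim k y s hlow.symm hnonCrit.symm hextra.symm
      hs₁.symm
    rw [heq]
    clear heq
    rcases hs₂ with rfl | ⟨x, s₃, hx, hs₃, hs₂⟩
    · refine key _ hI₁ hQ₁ rfl (fun _ => Iff.rfl) ?_
      change s.time + ((s.down y).length + low.length + 1) + p + 1 ≤ _
      rw [hpass]
      omega
    have hxmem : x ∈ low ∧ s.crit x = false := by
      have : x ∈ nonCrit := by rw [hx]; simp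
      simpa [hnonCrit] using this
    obtain ⟨hxlow, hxc⟩ := hxmem
    obtain ⟨hxdown, hxal⟩ : x ∈ s.down y ∧ s.alive x = true := by simpa [hlow] using hxlow
    have hI₃ : s₃.Inv I kit := by
      rw [hs₃]
      refine (hI₁.useWork (kit.invRegs_le (I.rank_le x) (I.rank_le y))).charge _ ?_
      have := mul_le_succ_sq (I.rank_le x) (I.rank_le y)
      omega
    have hQ₃ : s₃.QueueOK I.dim k := by
      rw [hs₃]; exact hq.congr rfl rfl hq.alive rfl
    have hP₃ : ∀ z, s₃.Pending z ↔ s.Pending z := fun z => by rw [hs₃]; rfl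
    have ht₃ : s₃.time ≤ s.time + ((s.down y).length + low.length + 1) + T := by
      rw [hs₃]
      exact Nat.add_le_add_left (kit.invTime_le (I.rank_le x) (I.rank_le y)) _
    have hc₃ : s₃.crit = s.crit := by rw [hs₃]; rfl
    rcases hs₂ with rfl | ⟨B, hB, rfl⟩
    · refine key _ hI₃ hQ₃ hc₃ hP₃ ?_
      rw [hpass]
      omega
    obtain ⟨q, qd, m, g1, g2, g3, -⟩ := enqueue_spec I.dim k (s.up x) s₃ hQ₃
    have hI₄ := hI₃.enqueue hQ₃ (s.up x)
    set s₄ := Store.enqueue I.dim k (s.up x) s₃ with hs₄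
    have f1 : s₄.alive = s.alive := by rw [g1, hs₃]; rfl
    have f2 : s₄.crit = s.crit := by rw [g1, hs₃]; rfl
    have f3 : s₄.down = s.down := by rw [g1, hs₃]; rfl
    have f4 : s₄.getBlk x y = s.getBlk x y := by rw [g1, hs₃]; rfl
    have f5 : s₄.time = s₃.time + (s.up x).length := by rw [g1]
    have hdx : I.dim x = k := by
      have := h.dim_blk x y ((h.tidy.mem_down x y).1 hxdown)
      omega
    have hyP : ¬ s.queued y = false → y ∉ s₄.queue := fun hqd hm =>
      ((hP₃ y).1 ((g3 y).1 (Or.inl hm))).elim hyq hqd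
    obtain ⟨r1, r2, r3, r4, r5, r6⟩ := hI₄.reducePair (x := x) (y := y) (low := low) (B := B)
      (by rw [f1]; exact hxal) (by rw [f1]; exact hy) (by rw [f2]; exact hxc)
      (by rw [f2]; exact hyc) (by rw [f3]; exact hxdown)
      (by
        rw [f1, f2, f3]
        intro w hw hwa hwc
        have : w ∈ nonCrit := by simp [hnonCrit, hlow, hw, hwa, hwc]
        rw [hx] at this
        simpa using this)
      hlown (by rw [f1, f3]; intro w; simp [hlow]) (by rw [f4]; exact hB)
    refine key _ r1 (g2.congr r3 r4 (fun z hz => ?_) r2) (r2.trans f2) (fun z => ?_) ?_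
    · refine r5 z (g2.alive z hz) ?_ ?_
      · rintro rfl
        have := g2.dim z hz
        omega
      · rintro rfl
        exact hyP (by simp [hyqd]) hz
    · rw [← hP₃, ← g3]
      simp only [Pending, r3, r4]
    · rw [f2, hdx, f5, h.up_eq x hxc] at r6
      have := I.length_up_le x
      rw [hpass]
      have e : p * (1 + M * (4 * T)) = p + p * (M * (4 * T)) := by ring
      rw [e] at r6
      omega
  intro s₂ h1 h2 h3 h4 h5
  obtain ⟨q, qd, m, g1, g2, g3, -⟩ := enqueue_spec I.dim k (s₂.up y) s₂ h2
  refine ⟨h1.enqueue h2 _, g2, ?_, fun z => (g3 z).trans (h4 z), ?_⟩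
  · rw [g1]; exact h3
  · rw [g1]
    change s₂.time + (s₂.up y).length + 1 ≤ _
    have := I.length_up_le y
    rw [h1.up_eq y (by rw [h3]; exact hyc)]
    omega

end Store

/-! ### The loops -/

namespace Store

variable {R : Type u} [Ring R] {X : Type v} [PartialOrder X] [Fintype X] [DecidableEq X]
  {I : Input.{u, v, w} R X} {kit : MatrixKit R} {s : Store R X I.rank}

open Classical in
/-- The set of pending elements. -/
def pendingSet {rank : X → ℕ} (s : Store R X rank) : Finset X := Finset.univ.filter s.Pending

theorem mem_pendingSet {rank : X → ℕ} {s : Store R X rank} {z : X} :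
    z ∈ s.pendingSet ↔ s.Pending z := by
  simp [pendingSet]

theorem Inv.innerLoop (N : ℕ) (h : s.Inv I kit) {k : ℕ} (hq : s.QueueOK I.dim k)
    (hN : s.pendingSet.card < N) :
    ∃ s', Store.innerLoop kit I.dim k N s = some s' ∧ s'.Inv I kit ∧ s'.crit = s.crit ∧
      s'.time ≤ s.time + 1 +
        ∑ z ∈ s.pendingSet, passCost I kit (critCount I.dim s.crit k) z := by
  induction N generalizing s with
  | zero => omega
  | succ N ih =>
    rcases hqueue : s.queue with _ | ⟨y, q⟩
    · refine ⟨s.charge 1 0, ?_, h.charge 1 (Nat.zero_le _), rfl, Nat.le_add_right _ _⟩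
      rw [Store.innerLoop, hqueue]
    · have hmem : y ∈ s.queue := by rw [hqueue]; simp
      have hnodup : y ∉ q ∧ q.Nodup := by
        have := hq.nodup
        rwa [hqueue, List.nodup_cons] at this
      set s₁ := ({ s with queue := q }).charge 1 0 with hs₁
      have hsub : ∀ z ∈ q, z ∈ s.queue := fun z hz => by rw [hqueue]; simp [hz]
      have hI₀ : ({ s with queue := q }).Inv I kit :=
        h.bookkeeping ⟨h.tidy.1, h.tidy.2, h.tidy.3, h.tidy.4, hnodup.2, h.tidy.6, h.tidy.7,
          h.tidy.8⟩
      have hI₁ : s₁.Inv I kit := hI₀.charge 1 (Nat.zero_le _)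
      have hQ₁ : s₁.QueueOK I.dim k := ⟨hnodup.2, fun z hz => hq.queued z (hsub z hz),
        fun z hz => hq.alive z (hsub z hz), fun z hz => hq.crit z (hsub z hz),
        fun z hz => hq.dim z (hsub z hz)⟩
      obtain ⟨h1, h2, h3, h4, h5⟩ := hI₁.process hQ₁ (hq.alive y hmem) (hq.crit y hmem)
        (hq.dim y hmem) hnodup.1 (hq.queued y hmem)
      have hP : s.pendingSet = insert y (Store.process kit I.dim k y s₁).pendingSet := by
        ext z
        simp only [mem_pendingSet, Finset.mem_insert, h4]
        change z ∈ s.queue ∨ s.queued z = false ↔ z = y ∨ z ∈ q ∨ s.queued z = false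
        rw [hqueue, List.mem_cons, or_assoc]
      have hyP : y ∉ (Store.process kit I.dim k y s₁).pendingSet := by
        simp only [mem_pendingSet, h4]
        rintro (hc | hc)
        · exact hnodup.1 hc
        · change s.queued y = false at hc
          rw [hq.queued y hmem] at hc
          exact Bool.noConfusion hc
      rw [hP, Finset.card_insert_of_notMem hyP] at hN
      obtain ⟨s', e1, e2, e3, e4⟩ := ih h1 h2 (by omega)
      refine ⟨s', ?_, e2, e3.trans h3, ?_⟩
      · rw [Store.innerLoop, hqueue]; exact e1
      · rw [hP, Finset.sum_insert hyP]
        rw [h3] at e4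
        have f1 : s₁.crit = s.crit := rfl
        have f2 : s₁.time = s.time + 1 := rfl
        rw [f1] at e4 h5
        rw [f2] at h5
        omega

theorem sum_passCost_le (M : ℕ) (t : Finset X) :
    ∑ z ∈ t, passCost I kit M z ≤ 3 * (Fintype.card X * maxCovers X) +
      Fintype.card X * (20 * ((maxCovers X + 1) * (M + 1) * kit.opTime I.maxRank)) := by
  refine (Finset.sum_le_sum_of_subset (Finset.subset_univ t)).trans ?_
  simp only [passCost]
  rw [Finset.sum_add_distrib, ← Finset.mul_sum, Finset.sum_const, Finset.card_univ, smul_eq_mul]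
  exact Nat.add_le_add_right (Nat.mul_le_mul_left _ I.sum_length_down_le) _

/-- The sum of the squares of the numbers of critical elements of each dimension. -/
def critSquares (dim : X → ℕ) (crit : X → Bool) : ℕ :=
  ∑ k ∈ Finset.univ.image dim, critCount dim crit k ^ 2

theorem critCount_update (dim : X → ℕ) {crit : X → Bool} {c : X} (hc : crit c = false) (k : ℕ) :
    critCount dim (Function.update crit c true) k =
      critCount dim crit k + if k = dim c then 1 else 0 := by
  have hiff : ∀ x, Function.update crit c true x = true ↔ x = c ∨ crit x = true := by
    intro x
    by_cases hx : x = c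
    · subst hx; simp
    · simp [hx]
  split_ifs with hk
  · have : (Finset.univ.filter fun x => Function.update crit c true x = true ∧ dim x = k) =
        insert c (Finset.univ.filter fun x => crit x = true ∧ dim x = k) := by
      ext x
      simp only [Finset.mem_filter, Finset.mem_univ, true_and, Finset.mem_insert, hiff]
      constructor
      · tauto
      · rintro (rfl | h)
        · exact ⟨Or.inl rfl, hk.symm⟩
        · exact ⟨Or.inr h.1, h.2⟩
    rw [critCount, this, Finset.card_insert_of_notMem (by simp [hc])]
    rfl
  · rw [critCount, critCount, add_zero]
    congr 1
    ext x
    simp only [Finset.mem_filter, Finset.mem_univ, true_and, hiff]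
    constructor
    · rintro ⟨rfl | h, h'⟩
      · exact absurd h'.symm hk
      · exact ⟨h, h'⟩
    · tauto

theorem critSquares_update_ge (dim : X → ℕ) {crit : X → Bool} {c : X} (hc : crit c = false) :
    critSquares dim crit + critCount dim (Function.update crit c true) (dim c) ≤
      critSquares dim (Function.update crit c true) := by
  have hmem : dim c ∈ Finset.univ.image dim := Finset.mem_image_of_mem _ (Finset.mem_univ c)
  rw [critSquares, critSquares, ← Finset.add_sum_erase _ _ hmem, ← Finset.add_sum_erase _ _ hmem]
  have h1 : ∑ k ∈ (Finset.univ.image dim).erase (dim c),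
      critCount dim (Function.update crit c true) k ^ 2 =
      ∑ k ∈ (Finset.univ.image dim).erase (dim c), critCount dim crit k ^ 2 := by
    refine Finset.sum_congr rfl fun k hk => ?_
    rw [critCount_update dim hc, if_neg (Finset.ne_of_mem_erase hk), add_zero]
  rw [h1, critCount_update dim hc, if_pos rfl]
  nlinarith

variable (I kit) in
/-- A bound for the time of one pass of the outer loop, per critical element of the dimension of
the element selected. -/
def passTime : ℕ :=
  72 * ((Fintype.card X + 1) * (maxCovers X + 1) * kit.opTime I.maxRank)

/-- One pass of the outer loop, for the minimal non-critical element `c`. -/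
theorem Inv.pass (h : s.Inv I kit) {c : X} (hal : s.alive c = true) (hcr : s.crit c = false)
    (hcnt : s.cnt c = 0) {N : ℕ} (hN : Fintype.card X + 2 ≤ N) :
    ∃ s', Store.innerLoop kit I.dim (I.dim c) N (resetQueue c (Store.mark c s)) = some s' ∧ s'.Inv I kit ∧
      s'.crit = Function.update s.crit c true ∧
      s'.time + Fintype.card X + 1 ≤ s.time + passTime I kit *
        critCount I.dim (Function.update s.crit c true) (I.dim c) := by
  have hI₁ := h.mark hal hcr
  have hbelow : ∀ x ∈ s.down c, s.alive x = true → s.crit x = true := by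
    intro x hx hxa
    by_contra hxc
    rw [Bool.not_eq_true] at hxc
    have hset := h.cnt_eq c
    rw [hcnt, eq_comm, Set.ncard_eq_zero] at hset
    have : x ∈ ({x | x ⋖ c ∧ s.alive x = true ∧ s.crit x = false} : Set X) :=
      ⟨(h.mem_down_iff hxc).1 hx, hxa, hxc⟩
    rw [hset] at this
    exact this
  obtain ⟨N, rfl⟩ : ∃ N', N = N' + 1 := ⟨N - 1, by omega⟩
  set k := I.dim c with hk
  set s₁ := Store.mark c s with hs₁
  have hm₁ := mark_eq c s
  rw [← hs₁] at hm₁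
  have f1 : s₁.crit = Function.update s.crit c true := by rw [hm₁]
  have f2 : s₁.alive = s.alive := by rw [hm₁]
  have f3 : s₁.down = s.down := by rw [hm₁]
  have f4 : s₁.up c = I.up c := by rw [hm₁]; exact h.up_eq c hcr
  have f5 : s₁.time = s.time + 1 + (I.up c).length := by rw [hm₁, h.up_eq c hcr]
  set s₂ := resetQueue c s₁ with hs₂
  have hI₂ : s₂.Inv I kit := by
    have h0 : ({ s₁ with
        queue := [c]
        queued := Function.update (fun _ => false) c true }).Inv I kit :=
      hI₁.bookkeeping ⟨hI₁.tidy.1, hI₁.tidy.2, hI₁.tidy.3, hI₁.tidy.4, List.nodup_singleton c,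
        hI₁.tidy.6, hI₁.tidy.7, hI₁.tidy.8⟩
    exact h0.charge _ (Nat.zero_le _)
  set s₃ := ({ s₂ with queue := [] }).charge 1 0 with hs₃
  have hI₃ : s₃.Inv I kit := by
    have h0 : ({ s₂ with queue := [] }).Inv I kit :=
      hI₂.bookkeeping ⟨hI₂.tidy.1, hI₂.tidy.2, hI₂.tidy.3, hI₂.tidy.4, List.nodup_nil,
        hI₂.tidy.6, hI₂.tidy.7, hI₂.tidy.8⟩
    exact h0.charge 1 (Nat.zero_le _)
  have hloop : Store.innerLoop kit I.dim k (N + 1) s₂ =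
      Store.innerLoop kit I.dim k N (Store.process kit I.dim k c s₃) := rfl
  set low := (s₃.down c).filter (fun x => s₃.alive x) with hlow
  have hnil : low.filter (fun x => !s₃.crit x) = [] := by
    rw [List.filter_eq_nil_iff]
    intro x hx
    obtain ⟨hx1, hx2⟩ := List.mem_filter.1 hx
    change x ∈ s₁.down c at hx1
    change s₁.alive x = true at hx2
    change ¬ ((!s₁.crit x) = true)
    rw [f3] at hx1
    rw [f2] at hx2
    rw [f1]
    by_cases hxc : x = c
    · subst hxc; simp
    · simp [hxc, hbelow x hx1 hx2]
  set s₄ := s₃.charge ((s₃.down c).length + low.length + 1) (2 * low.length + 2 * 0) with hs₄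
  have hlowlen : low.length ≤ (s₃.down c).length := List.length_filter_le _ _
  have hdownlen : (s₃.down c).length ≤ Fintype.card X := (hI₃.tidy.nodup_down c).length_le_card
  have hI₄ : s₄.Inv I kit := by
    refine hI₃.charge _ ?_
    have hD : 1 ≤ (I.maxRank + 1) ^ 2 := Nat.one_le_pow _ _ (Nat.succ_pos _)
    have h1 := Nat.le_mul_of_pos_right ((Fintype.card X + 1) ^ 2) hD
    have h2 : Fintype.card X ≤ (Fintype.card X + 1) ^ 2 := by nlinarith
    omega
  have hproc : Store.process kit I.dim k c s₃ = Store.enqueue I.dim k (s₄.up c) s₄ := by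
    obtain ⟨s', e1, e2⟩ := exists_process_eq kit I.dim k c s₃ hlow.symm hnil rfl rfl
    rcases e2 with rfl | ⟨x, -, hx, -⟩
    · exact e1
    · simp at hx
  have hQ₄ : s₄.QueueOK I.dim k := by
    have : s₄.queue = [] := rfl
    refine ⟨?_, ?_, ?_, ?_, ?_⟩ <;> simp [this]
  obtain ⟨q, qd, m, g1, g2, g3, -⟩ := enqueue_spec I.dim k (s₄.up c) s₄ hQ₄
  have hI₅ := hI₄.enqueue hQ₄ (s₄.up c)
  set s₅ := Store.enqueue I.dim k (s₄.up c) s₄ with hs₅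
  have hcard : s₅.pendingSet.card < N :=
    lt_of_le_of_lt (Finset.card_le_univ _) (by omega)
  obtain ⟨s', e1, e2, e3, e4⟩ := hI₅.innerLoop N g2 hcard
  have c1 : s₅.crit = Function.update s.crit c true := by rw [g1]; exact f1
  have t1 : s₅.time = s.time + 1 + (I.up c).length + (Fintype.card X + 2) + 1 +
      ((s₃.down c).length + low.length + 1) + (I.up c).length := by
    rw [g1]
    change s₁.time + (Fintype.card X + 2) + 1 + ((s₃.down c).length + low.length + 1) +
      (s₁.up c).length = _
    rw [f4, f5]
  refine ⟨s', by rw [hloop, hproc]; exact e1, e2, e3.trans c1, ?_⟩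
  rw [c1] at e4
  have hsum := sum_passCost_le (I := I) (kit := kit)
    (critCount I.dim (Function.update s.crit c true) k) s₅.pendingSet
  have hM : 1 ≤ critCount I.dim (Function.update s.crit c true) k := by
    rw [critCount_update I.dim hcr, if_pos rfl]; omega
  have hT : 2 ≤ kit.opTime I.maxRank := by
    simpa using kit.mul_add_two_le_opTime (d := I.maxRank) (Nat.zero_le I.maxRank)
      (Nat.zero_le I.maxRank)
  have hup := I.length_up_le c
  have htot : s'.time + Fintype.card X + 1 ≤ s.time +
      (5 * Fintype.card X + 2 * maxCovers X + 7 + 3 * (Fintype.card X * maxCovers X) +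
      Fintype.card X * (20 * ((maxCovers X + 1) *
        (critCount I.dim (Function.update s.crit c true) k + 1) * kit.opTime I.maxRank))) := by
    omega
  refine htot.trans (Nat.add_le_add_left ?_ _)
  rw [passTime]
  generalize critCount I.dim (Function.update s.crit c true) k = M at hM
  generalize kit.opTime I.maxRank = T at hT
  generalize Fintype.card X = n
  generalize maxCovers X = p
  have hMT : 1 ≤ M * T := Nat.mul_pos hM (by omega)
  have a1 : (n + 1) * (p + 1) ≤ (n + 1) * (p + 1) * T * M := by
    rw [mul_assoc _ T M, mul_comm T M]; exact Nat.le_mul_of_pos_right _ hMT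
  have a2 : n * (20 * ((p + 1) * (M + 1) * T)) ≤ 40 * ((n + 1) * (p + 1) * T * M) := by
    have b1 : n * (20 * ((p + 1) * (M + 1) * T)) = 20 * (n * ((p + 1) * T)) * (M + 1) := by ring
    have b2 : 40 * ((n + 1) * (p + 1) * T * M) = 20 * ((n + 1) * ((p + 1) * T)) * (2 * M) := by
      ring
    rw [b1, b2]
    refine Nat.mul_le_mul (Nat.mul_le_mul_left _ (Nat.mul_le_mul_right _ (by omega))) (by omega)
  have a3 : 5 * n + 2 * p + 7 + 3 * (n * p) ≤ 7 * ((n + 1) * (p + 1)) := by nlinarith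
  have a4 : 72 * ((n + 1) * (p + 1) * T) * M = 72 * ((n + 1) * (p + 1) * T * M) := by ring
  omega

theorem Inv.exists_minimal (h : s.Inv I kit) {x : X} (hx : s.alive x = true)
    (hxc : s.crit x = false) :
    ∃ c, s.alive c = true ∧ s.crit c = false ∧ s.cnt c = 0 := by
  obtain ⟨c, hc, hmin⟩ := Finset.exists_min_image
    (Finset.univ.filter fun x => s.alive x = true ∧ s.crit x = false) I.dim
    ⟨x, by simp [hx, hxc]⟩
  simp only [Finset.mem_filter, Finset.mem_univ, true_and] at hc hmin
  refine ⟨c, hc.1, hc.2, ?_⟩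
  rw [h.cnt_eq, Set.ncard_eq_zero]
  refine Set.eq_empty_of_forall_notMem fun z hz => ?_
  have h1 := I.dim_covBy z c hz.1
  have h2 := hmin z hz.2
  omega

theorem Inv.outerLoop (N M : ℕ) (hM : Fintype.card X + 2 ≤ M) (h : s.Inv I kit)
    (hN : (Finset.univ.filter fun x => s.crit x = false).card < N) :
    ∃ out, Store.outerLoop kit I.dim I.elems M N s = some out ∧ out.Inv I kit ∧
      (∀ x, out.alive x = true → out.crit x = true) ∧
      ((∃ x, s.alive x = true) → ∃ x, out.crit x = true) ∧
      out.time + passTime I kit * critSquares I.dim s.crit ≤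
        s.time + Fintype.card X + 1 + passTime I kit * critSquares I.dim out.crit := by
  induction N generalizing s with
  | zero => omega
  | succ N ih =>
    set s₁ := s.charge (I.elems.length + 1) 0 with hs₁
    have hI₁ : s₁.Inv I kit := h.charge _ (Nat.zero_le _)
    have ht₁ : s₁.time = s.time + Fintype.card X + 1 := by
      change s.time + (I.elems.length + 1) = _
      rw [I.length_elems, add_assoc]
    rcases hfind : I.elems.find? fun x => s₁.alive x && !s₁.crit x && decide (s₁.cnt x = 0)
      with _ | c
    · have hall : ∀ x, s₁.alive x = true → s₁.crit x = true := by
        intro x hx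
        by_contra hxc
        obtain ⟨c, h1, h2, h3⟩ := hI₁.exists_minimal hx (by simpa using hxc)
        have := List.find?_eq_none.1 hfind c (I.mem_elems c)
        simp [h1, h2, h3] at this
      refine ⟨s₁, ?_, hI₁, hall, fun ⟨x, hx⟩ => ⟨x, hall x hx⟩, ?_⟩
      · rw [Store.outerLoop]; simp only [← hs₁, hfind]
      · rw [ht₁]
        exact le_rfl
    · have hc := List.find?_some hfind
      simp only [Bool.and_eq_true, Bool.not_eq_true', decide_eq_true_eq] at hc
      obtain ⟨⟨hal, hcr⟩, hcnt⟩ := hc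
      obtain ⟨s', e1, e2, e3, e4⟩ := hI₁.pass hal hcr hcnt hM
      have hlt : (Finset.univ.filter fun x => s'.crit x = false).card <
          (Finset.univ.filter fun x => s.crit x = false).card := by
        refine Finset.card_lt_card (Finset.ssubset_iff_subset_ne.2 ⟨fun x hx => ?_, fun he => ?_⟩)
        · simp only [Finset.mem_filter, Finset.mem_univ, true_and, e3] at hx ⊢
          by_cases hxc : x = c
          · subst hxc; exact hcr
          · rwa [Function.update_of_ne hxc] at hx
        · have : c ∈ Finset.univ.filter fun x => s.crit x = false := by
            simp only [Finset.mem_filter, Finset.mem_univ, true_and]; exact hcr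
          rw [← he] at this
          simp [e3] at this
      obtain ⟨out, o1, o2, o3, o5, o4⟩ := ih e2 (by omega)
      refine ⟨out, ?_, o2, o3, fun _ => o5 ⟨c, e2.crit_alive c (by simp [e3])⟩, ?_⟩
      · rw [Store.outerLoop]; simp only [← hs₁, hfind, e1, Option.bind_some]; exact o1
      · have hge := critSquares_update_ge I.dim (crit := s.crit) hcr
        rw [e3] at o4
        have hA := Nat.mul_le_mul_left (passTime I kit) hge
        rw [Nat.mul_add] at hA
        have f1 : s₁.crit = s.crit := rfl
        rw [f1] at o4 e4
        omega

end Store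

/-! ### Initialization -/

namespace Input

variable {R : Type u} [Ring R] {X : Type v} [PartialOrder X] [Fintype X] [DecidableEq X]
  (I : Input.{u, v, w} R X) (kit : MatrixKit R)

theorem foldl_initCounters (l : List X) (s : Store R X I.rank) :
    ∃ m, l.foldl (fun s x => ({ s with
        cnt := Function.update s.cnt x (s.down x).length }).charge ((s.down x).length + 1) 0) s =
      { s with
        cnt := fun z => if z ∈ l then (s.down z).length else s.cnt z
        time := s.time + (l.map fun x => (s.down x).length + 1).sum
        mem := m } ∧ ∀ b, s.mem ≤ b → s.size ≤ b → m ≤ b := by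
  induction l generalizing s with
  | nil => exact ⟨s.mem, by simp, fun b h _ => h⟩
  | cons a l ih =>
    obtain ⟨m, h1, h2⟩ := ih (({ s with
        cnt := Function.update s.cnt a (s.down a).length }).charge ((s.down a).length + 1) 0)
    refine ⟨m, ?_, fun b hb hs => h2 b (max_le hb hs) hs⟩
    rw [List.foldl_cons, h1]
    simp only [Store.charge, List.map_cons, List.sum_cons, List.mem_cons]
    congr 1
    · funext z
      by_cases hz : z = a
      · subst hz; simp
      · simp [hz]
    · omega

theorem isSome_load_blk (x y : X) : (I.load.blk x y).isSome = true ↔ x ⋖ y := by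
  simp only [load]
  split_ifs with h <;> simp [h]

theorem getBlk_load (x y : X) : I.load.getBlk x y = I.matrixOf (I.F.map x y) := by
  simp only [load, Store.getBlk]
  split_ifs with h
  · rfl
  · rw [I.F.map_eq_zero x y h, I.matrixOf_zero]; rfl

theorem tidy_load : I.load.Tidy kit I.maxRank :=
  ⟨I.nodup_up, I.nodup_down, fun w z => (I.mem_up w z).trans (I.isSome_load_blk w z).symm,
    fun w z => (I.mem_down w z).trans (I.isSome_load_blk w z).symm, List.nodup_nil,
    Nat.zero_le _, Nat.zero_le _, Nat.zero_le _⟩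

theorem inv_initCounters :
    (I.initCounters I.load).Inv I kit ∧ (∀ x, (I.initCounters I.load).alive x = true) ∧
    (I.initCounters I.load).time ≤
      Fintype.card X * maxCovers X + Fintype.card X := by
  have hT := (I.tidy_load kit).charge I.rank_le 0 (Nat.zero_le _)
  obtain ⟨m, h1, h2⟩ := I.foldl_initCounters I.elems (I.load.charge 0 0)
  have hinit : I.initCounters I.load = _ := h1
  have hmap : ∀ x y, morseMap I.F.toBlockData {r | r ∈ ([] : List (X × X))} x y = I.F.map x y :=
    fun x y => morseMap_of_free _ (by simp) y
  have hcov : ∀ x y : X, MorseCovers {r | r ∈ ([] : List (X × X))} x y ↔ x ⋖ y :=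
    fun x y => morseCovers_of_free (by simp)
  rw [hinit]
  refine ⟨⟨⟨hT.1, hT.2, hT.3, hT.4, hT.5, hT.6,
    h2 _ hT.mem_le (hT.size_le_memBound I.rank_le), hT.8⟩, fun _ _ => rfl, ?_, ?_, trivial, ?_, ?_,
    ?_, ?_, ?_⟩, fun x => rfl, ?_⟩
  · intro x hx; exact Bool.noConfusion hx
  · intro x
    refine ⟨fun _ z => ?_, fun _ => rfl⟩
    change (x, z) ∉ {r | r ∈ ([] : List (X × X))} ∧ (z, x) ∉ {r | r ∈ ([] : List (X × X))}
    simp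
  · intro x _ _ r hr; exact absurd hr List.not_mem_nil
  · intro w z hwz
    exact I.dim_covBy w z ((I.isSome_load_blk w z).1 hwz)
  · intro w z _ _
    exact (I.isSome_load_blk w z).trans (hcov w z).symm
  · intro w z _ _
    exact (I.getBlk_load w z).trans (congrArg _ (hmap w z).symm)
  · intro z
    change (if z ∈ I.elems then (I.down z).length else 0) =
      Set.ncard {x | x ⋖ z ∧ true = true ∧ false = false}
    rw [if_pos (I.mem_elems z), ← List.toFinset_card_of_nodup (I.nodup_down z),
      ← Set.ncard_coe_finset]
    congr 1
    ext x
    simp [I.mem_down]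
  · change 0 + 0 + (I.elems.map fun x => (I.down x).length + 1).sum ≤ _
    rw [← List.sum_toFinset _ I.nodup_elems]
    have : I.elems.toFinset = Finset.univ := by ext x; simp [I.mem_elems]
    rw [this, Finset.sum_add_distrib]
    have := I.sum_length_down_le
    simp
    omega

end Input

end Scythe

end

theorem theorem4p1 {R : Type u} [Ring R] (kit : MatrixKit R) (ω : ℝ)
    (hω : kit.HasExponent ω) :
    ∃ C : ℝ, ∀ (X : Type v) [PartialOrder X] [Fintype X] [DecidableEq X]
      (I : Input.{u, v, w} R X),
      ∃ (N : ℕ) (out : Store R X I.rank) (S : Set (X × X)),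
        -- the algorithm terminates; `S` is the set of pairs passed to `ReducePair`
        I.scythe kit N = some out ∧ S = {q | q ∈ out.pairs} ∧
        -- `S` is an acyclic matching on `X`, compatible with the parametrization
        IsAcyclicMatching S ∧ IsCompatible I.F.toBlockData S ∧
        -- what is left of `X` are the critical elements, with the Morse covering relation
        (∀ x, out.alive x = true ↔ IsCritical S x) ∧
        (∀ x, out.crit x = true ↔ IsCritical S x) ∧
        (∀ m m', IsCritical S m → IsCritical S m' →
          (m' ∈ out.up m ↔ MorseCovers S m m') ∧ (m ∈ out.down m' ↔ MorseCovers S m m') ∧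
          ((out.blk m m').isSome = true ↔ MorseCovers S m m')) ∧
        IsPartialOrder {m : X // IsCritical S m} (MorseLE S) ∧
        (∀ m m', MorseCovers S m m' → I.dim m' = I.dim m + 1) ∧
        -- the stored matrices are those of the Morse parametrization
        (∀ m m', IsCritical S m → IsCritical S m' →
          out.getBlk m m' = I.matrixOf (morseMap I.F.toBlockData S m m')) ∧
        (morseData I.F.toBlockData S).IsCochainComplex (fun m => I.dim m.1) ∧
        -- time and space
        (1 ≤ maxCovers X → 1 ≤ I.maxRank →
          (out.time : ℝ) ≤ C * Fintype.card X * maxCovers X * I.critSq S *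
            (I.maxRank : ℝ) ^ ω ∧
          (out.mem : ℝ) ≤ C * Fintype.card X ^ 2 * maxCovers X * I.maxRank ^ 2 ∧
          ∀ W : ℕ, kit.HasWorkspace W →
            ((out.mem + out.work : ℕ) : ℝ) ≤
              (C + W) * Fintype.card X ^ 2 * maxCovers X * I.maxRank ^ 2) := by
  obtain ⟨C₀, hC₀, hop⟩ := hω.exists_opTime_le
  refine ⟨292 * C₀ + 768 + kit.mulRegs 0, fun X _ _ _ I => ?_⟩
  obtain ⟨hI, halive, htime⟩ := I.inv_initCounters kit
  obtain ⟨out, hout, hinv, hcrit, hne, ht⟩ := hI.outerLoop (Fintype.card X + 2)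
    (Fintype.card X + 2) le_rfl (lt_of_le_of_lt (Finset.card_le_univ _) (by omega))
  have hcrit_iff : ∀ x, out.crit x = true ↔ IsCritical {q | q ∈ out.pairs} x := fun x =>
    ⟨fun h => (hinv.alive_iff x).1 (hinv.crit_alive x h), fun h =>
      hcrit x ((hinv.alive_iff x).2 h)⟩
  have hdim : ∀ m m', MorseCovers {q | q ∈ out.pairs} m m' → I.dim m' = I.dim m + 1 :=
    fun m m' => hinv.seq.dim_of_morseCovers I.dim_covBy
  refine ⟨Fintype.card X + 2, out, {q | q ∈ out.pairs}, hout, rfl, hinv.seq.isAcyclicMatching,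
    hinv.seq.isCompatible, hinv.alive_iff, hcrit_iff, fun m m' hm hm' => ?_,
    isPartialOrder_morseLE hdim, hdim, fun m m' hm hm' => ?_,
    hinv.seq.isCochainComplex I.dim_covBy I.F.map_eq_zero I.F.isCochainComplex, fun hp hd => ?_⟩
  · have hcov := hinv.covers m m' ((hinv.alive_iff m).2 hm) ((hinv.alive_iff m').2 hm')
    exact ⟨(hinv.tidy.mem_up m m').trans hcov, (hinv.tidy.mem_down m m').trans hcov, hcov⟩
  · exact hinv.getBlk_eq m m' ((hinv.alive_iff m).2 hm) ((hinv.alive_iff m').2 hm')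
  have hn : 1 ≤ Fintype.card X := by
    by_contra hc
    have : IsEmpty X := Fintype.card_eq_zero_iff.1 (by omega)
    simp [maxCovers] at hp
  obtain ⟨x₀⟩ : Nonempty X := Fintype.card_pos_iff.1 hn
  obtain ⟨c, hc⟩ := hne ⟨x₀, halive x₀⟩
  have hsq : I.critSq {q | q ∈ out.pairs} = Store.critSquares I.dim out.crit := by
    refine Finset.sum_congr rfl fun k _ => ?_
    rw [Store.critCount, ← Set.ncard_coe_finset]
    congr 2
    ext x
    simp [hcrit_iff]
  have hΦ : 1 ≤ Store.critSquares I.dim out.crit := by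
    refine le_trans ?_ (Finset.single_le_sum (f := fun k => Store.critCount I.dim out.crit k ^ 2)
      (fun _ _ => Nat.zero_le _) (Finset.mem_image_of_mem I.dim (Finset.mem_univ c)))
    exact Nat.one_le_pow _ _ (Finset.card_pos.2 ⟨c, by simp [hc]⟩)
  have hT : 2 ≤ kit.opTime I.maxRank := by
    simpa using kit.mul_add_two_le_opTime (d := I.maxRank) (Nat.zero_le I.maxRank)
      (Nat.zero_le I.maxRank)
  have hmem := hinv.tidy.mem_le
  have hwork := hinv.tidy.work_le
  have hop' := hop I.maxRank hd
  rw [hsq]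
  rw [Store.passTime] at ht
  rw [Store.memBound] at hmem
  generalize Store.critSquares I.dim out.crit = Φ at *
  generalize kit.opTime I.maxRank = T at *
  generalize Fintype.card X = n at *
  generalize maxCovers X = p at *
  set d := I.maxRank with hd_def
  have hmemN : out.mem ≤ 768 * (n ^ 2 * p * d ^ 2) := by
    have h1 : (n + 1) ^ 2 ≤ (2 * n) ^ 2 := Nat.pow_le_pow_left (by omega) 2
    have h2 : (d + 1) ^ 2 ≤ (2 * d) ^ 2 := Nat.pow_le_pow_left (by omega) 2
    have h3 := Nat.mul_le_mul h1 h2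
    have h4 : n ^ 2 * d ^ 2 ≤ n ^ 2 * d ^ 2 * p := Nat.le_mul_of_pos_right _ hp
    have h5 : (2 * n) ^ 2 * (2 * d) ^ 2 = 16 * (n ^ 2 * d ^ 2) := by ring
    have h6 : n ^ 2 * d ^ 2 * p = n ^ 2 * p * d ^ 2 := by ring
    omega
  have htimeN : out.time ≤ 292 * (n * p * Φ * T) := by
    have h1 : (n + 1) * (p + 1) ≤ (2 * n) * (2 * p) := Nat.mul_le_mul (by omega) (by omega)
    have h2 := Nat.mul_le_mul_right (T * Φ) h1
    have h3 : 72 * ((n + 1) * (p + 1) * T) * Φ = 72 * ((n + 1) * (p + 1) * (T * Φ)) := by ring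
    have h4 : 2 * n * (2 * p) * (T * Φ) = 4 * (n * p * Φ * T) := by ring
    have h5 : n * p ≤ n * p * (Φ * T) := Nat.le_mul_of_pos_right _ (Nat.mul_pos hΦ (by omega))
    have h6 : n * p * (Φ * T) = n * p * Φ * T := by ring
    have h7 : n ≤ n * p := Nat.le_mul_of_pos_right _ hp
    have h8 := Nat.zero_le (72 * ((n + 1) * (p + 1) * T) * Store.critSquares I.dim
      (I.initCounters I.load).crit)
    omega
  have hmemR : (out.mem : ℝ) ≤ 768 * ((n : ℝ) ^ 2 * p * d ^ 2) := by exact_mod_cast hmemN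
  have htimeR : (out.time : ℝ) ≤ 292 * ((n : ℝ) * p * Φ * T) := by exact_mod_cast htimeN
  have hregs : (0 : ℝ) ≤ kit.mulRegs 0 := Nat.cast_nonneg _
  have hsp : (0 : ℝ) ≤ (n : ℝ) ^ 2 * p * d ^ 2 := by positivity
  refine ⟨?_, ?_, fun W hW => ?_⟩
  · have h0 : (0 : ℝ) ≤ (n : ℝ) * p * Φ := by positivity
    have hdω : (0 : ℝ) ≤ (d : ℝ) ^ ω := by positivity
    have h1 := mul_le_mul_of_nonneg_left hop' h0
    have h2 : (0 : ℝ) ≤ (768 + kit.mulRegs 0) * ((n : ℝ) * p * Φ * (d : ℝ) ^ ω) := by positivity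
    calc (out.time : ℝ) ≤ 292 * ((n : ℝ) * p * Φ * T) := htimeR
      _ ≤ 292 * ((n : ℝ) * p * Φ * (C₀ * (d : ℝ) ^ ω)) := by linarith
      _ ≤ 292 * ((n : ℝ) * p * Φ * (C₀ * (d : ℝ) ^ ω)) +
          (768 + kit.mulRegs 0) * ((n : ℝ) * p * Φ * (d : ℝ) ^ ω) := by linarith
      _ = _ := by ring
  · have h2 : (0 : ℝ) ≤ (292 * C₀ + kit.mulRegs 0) * ((n : ℝ) ^ 2 * p * d ^ 2) := by positivity
    calc (out.mem : ℝ) ≤ 768 * ((n : ℝ) ^ 2 * p * d ^ 2) +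
          (292 * C₀ + kit.mulRegs 0) * ((n : ℝ) ^ 2 * p * d ^ 2) := by linarith
      _ = _ := by ring
  · have hw : out.work ≤ (kit.mulRegs 0 + W) * (n ^ 2 * p * d ^ 2) := by
      have h1 := hW.opRegs_le hd
      have hnp : 1 ≤ n ^ 2 * p := Nat.mul_pos (Nat.one_le_pow _ _ hn) hp
      have h2 : d ^ 2 ≤ n ^ 2 * p * d ^ 2 := Nat.le_mul_of_pos_left _ hnp
      have h3 : 1 ≤ n ^ 2 * p * d ^ 2 := Nat.mul_pos hnp (Nat.one_le_pow _ _ hd)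
      have h4 : kit.mulRegs 0 ≤ kit.mulRegs 0 * (n ^ 2 * p * d ^ 2) :=
        Nat.le_mul_of_pos_right _ h3
      have h5 := Nat.mul_le_mul_left W h2
      rw [Nat.add_mul]
      omega
    have hwR : (out.work : ℝ) ≤ (kit.mulRegs 0 + W) * ((n : ℝ) ^ 2 * p * d ^ 2) := by
      exact_mod_cast hw
    have h2 : (0 : ℝ) ≤ 292 * C₀ * ((n : ℝ) ^ 2 * p * d ^ 2) := by positivity
    push_cast
    calc (out.mem : ℝ) + out.work ≤ 768 * ((n : ℝ) ^ 2 * p * d ^ 2) +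
          (kit.mulRegs 0 + W) * ((n : ℝ) ^ 2 * p * d ^ 2) +
          292 * C₀ * ((n : ℝ) ^ 2 * p * d ^ 2) := by linarith
      _ = _ := by ring
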